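/- Let $\alpha>0$. For positive integers $m,n$ let $H$ be an $m\times n$ random matrix with i.i.d. standard normal entries and let $$\xi_n=\min_{x\in\{-\frac1{\sqrt n},\frac1{\sqrt n}\}^n}\ \max_{y\in\{-\frac1{\sqrt m},\frac1{\sqrt m}\}^m} y^THx .$$ With $\operatorname{erfc}(z)=\frac{2}{\sqrt\pi}\int_z^\infty e^{-t^2}\,dt$, put $$\xi^{(l,lift)}(\alpha)=\max_{c>0}\Big(-\frac c2-\frac1c\log\operatorname{erfc}\Big(-\frac{c}{\sqrt2}\Big)-\frac{\alpha}{c}\log\operatorname{erfc}\Big(\frac{c}{\sqrt{2\alpha}}\Big)\Big).$$ Then this maximum is attained, and: 1. For all integers $n\ge1$, $m$ with $m=\alpha n$, the variable $\xi_n$ is integrable and $$\frac{E\,\xi_n}{\sqrt n}\ \ge\ \xi^{(l,lift)}(\alpha).$$ 2. Along every sequence of dimensions with $n\to\infty$ and $m/n\to\alpha$ (in particular if $m=\alpha n$): for every real $s<\xi^{(l,lift)}(\alpha)$, one has $E\,\xi_n/\sqrt n\ge s$ for all sufficiently late terms of the sequence, and $P(\xi_n\ge s\sqrt n)\to1$;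 if moreover $s\ge0$, then $P(\xi_n^2\ge s^2n)\to1$. Also $P(\xi_n\ge\xi^{(l,lift)}(\alpha))\to1$ and $P(\xi_n^2\ge(\xi^{(l,lift)}(\alpha))^2)\to1$. 3. For $\alpha=1$ one has $\xi^{(l,lift)}(1)=0.24439$ to five decimals, i.e. $|\xi^{(l,lift)}(1)-0.24439|\le 5\cdot10^{-6}$; in particular $E\,\xi_n/\sqrt n\ge\xi^{(l,lift)}(1)\approx 0.24439$ whenever $m=n\ge1$. -/

import Mathlib

open MeasureTheory ProbabilityTheory Filter Topology Set

universe u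

noncomputable section

namespace LittleModel

/-- The scaled binary cube `{-1/√n, 1/√n}^n`. -/
def spinCube (n : ℕ) : Finset (Fin n → ℝ) :=
  Fintype.piFinset fun _ => {-(1 / √(n : ℝ)), 1 / √(n : ℝ)}

theorem spinCube_nonempty (n : ℕ) : (spinCube n).Nonempty := by
  simp [spinCube, Fintype.piFinset_nonempty]

/-- The optimal value `ξ_n = min_x max_y yᵀ H x` of the minmax asymmetric Little form, where `x`
and `y` range over the scaled cubes of dimensions `n` and `m`. -/
def minmaxForm {m n : ℕ} (H : Matrix (Fin m) (Fin n) ℝ) : ℝ :=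
  (spinCube n).inf' (spinCube_nonempty n) fun x =>
    (spinCube m).sup' (spinCube_nonempty m) fun y => y ⬝ᵥ (H.mulVec x)

/-- The random matrix `H` has independent standard normal entries. -/
structure IsStdGaussianMatrix {m n : ℕ} {Ω : Type*} [MeasurableSpace Ω]
    (H : Ω → Matrix (Fin m) (Fin n) ℝ) (P : Measure Ω) : Prop where
  hasLaw : ∀ i j, HasLaw (fun ω => H ω i j) (gaussianReal 0 1) P
  indep : iIndepFun (fun (p : Fin m × Fin n) ω => H ω p.1 p.2) P

/-- The complementary error function `erfc x = (2/√π) ∫_x^∞ exp(-t²) dt`. -/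
def erfc (x : ℝ) : ℝ :=
  2 / √Real.pi * ∫ t in Ioi x, Real.exp (-t ^ 2)

/-- The function of `c` that is maximized in the lifted lower bound. -/
def liftFun (α c : ℝ) : ℝ :=
  -c / 2 - 1 / c * Real.log (erfc (-c / √2)) - α / c * Real.log (erfc (c / √(2 * α)))

/-- The lifted lower bound: the maximum of `liftFun α c` over `c > 0`. -/
def liftedBound (α : ℝ) : ℝ :=
  sSup (liftFun α '' Ioi 0)

end LittleModel

end

namespace LittleModel

/-! The bound comes from Gordon's comparison of two Gaussian processes on pairs `(x, y)` of cube
points: `yᵀHx + g`, with an extra independent normal `g`, and the decoupled `gᵀy + hᵀx`, with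
independent standard Gaussian vectors. All cube points are unit vectors, so the covariances are `1 +
(x·x')(y·y')` and `x·x' + y·y'`. Their difference `(1 - x·x')(1 - y·y')` is nonnegative, and
vanishes when `x = x'`. Hence the minmax of the first process has the lighter lower tail
(`measure_minMax_le`).

Gordon's inequality is proved by interpolating between the processes through an angle `θ`. For a
smooth surrogate `f` of the indicator of `min_x max_y z > l`, Gaussian integration by parts turns
the `θ`-derivative of `E f` into the covariance difference paired with the Hessian of `f`
(`gaussian_comparison`). The mixed derivatives that matter, those between distinct `x`, are
nonnegative because `f` is a product over `x` of nondecreasing factors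
(`fderiv_fderiv_smoothMinMax_nonneg`).

Lighter lower tails give smaller exponential moments `E exp(-c ·)`. The decoupled minmax is at least
`‖g‖₁/√m - ‖h‖₁/√n`, whose exponential moment factors over coordinates into values of `erfc`. With
parameter `c√n` this yields `E exp(-c√n ξ) ≤ exp(-n c liftFun (m/n) c)`
(`IsStdGaussianMatrix.lintegral_exp_le`). Jensen's inequality then bounds the mean, and Markov's
inequality bounds the lower tail by an exponentially small quantity.

The maximum over `c` is attained because `liftFun` takes a positive value, drops below any positive
level at infinity, and near zero is a quotient `liftPot α c / c` with convex numerator vanishing at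
`0` (`exists_isMaxOn_liftFun`).

For `α = 1` the two `erfc` factors combine, and `liftFun 1 c ≤ M` becomes `liftGap M c ≥ 0`. The
sign pattern of two successive derivatives reduces this to checks near the single point `c = 3.617`
(`liftGap_nonneg`), made with alternating Taylor bounds. -/

/-- The standard Gaussian measure on `ι → ℝ`. -/
noncomputable abbrev stdPi (ι : Type*) [Fintype ι] : Measure (ι → ℝ) :=
  Measure.pi fun _ => gaussianReal 0 1

/-! ### Integration by parts for one standard normal variable. -/

theorem gaussianPDFReal_zero_one (x : ℝ) :
    gaussianPDFReal 0 1 x = (√(2 * Real.pi))⁻¹ * Real.exp (-x ^ 2 / 2) := by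
  simp [gaussianPDFReal]

theorem hasDerivAt_gaussianPDFReal (x : ℝ) :
    HasDerivAt (gaussianPDFReal 0 1) (-(x * gaussianPDFReal 0 1 x)) x := by
  have h : HasDerivAt (fun x : ℝ => (√(2 * Real.pi))⁻¹ * Real.exp (-x ^ 2 / 2))
      ((√(2 * Real.pi))⁻¹ * (Real.exp (-x ^ 2 / 2) * (-(2 * x) / 2))) x := by
    have h1 : HasDerivAt (fun x : ℝ => -x ^ 2 / 2) (-(2 * x) / 2) x := by
      simpa using ((hasDerivAt_pow 2 x).neg.div_const 2)
    exact h1.exp.const_mul _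
  rw [show gaussianPDFReal 0 1 = fun x : ℝ => (√(2 * Real.pi))⁻¹ * Real.exp (-x ^ 2 / 2) from
    funext gaussianPDFReal_zero_one]
  convert h using 1
  ring

theorem integrable_id_gaussian : Integrable (fun x : ℝ => x) (gaussianReal 0 1) :=
  (memLp_id_gaussianReal (μ := 0) (v := 1) 1).integrable le_rfl

theorem integrable_mul_gaussianPDFReal {g : ℝ → ℝ} (hg : Integrable g (gaussianReal 0 1)) :
    Integrable (fun x => g x * gaussianPDFReal 0 1 x) := by
  rw [gaussianReal_of_var_ne_zero 0 one_ne_zero,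
    integrable_withDensity_iff_integrable_smul' (measurable_gaussianPDF 0 1)
      (ae_of_all _ fun x => gaussianPDF_lt_top)] at hg
  refine hg.congr (ae_of_all _ fun x => ?_)
  simp [gaussianPDF, ENNReal.toReal_ofReal (gaussianPDFReal_nonneg 0 1 x), mul_comm]

theorem integral_gaussian_eq (g : ℝ → ℝ) :
    ∫ x, g x ∂(gaussianReal 0 1) = ∫ x, g x * gaussianPDFReal 0 1 x := by
  rw [integral_gaussianReal_eq_integral_smul one_ne_zero]
  simp [mul_comm]

/-- Gaussian integration by parts on the line. -/
theorem integral_mul_gaussian {g g' : ℝ → ℝ} {C : ℝ} (hd : ∀ x, HasDerivAt g (g' x) x)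
    (hg' : Continuous g') (hC : ∀ x, |g x| ≤ C) (hC' : ∀ x, |g' x| ≤ C) :
    ∫ x, x * g x ∂(gaussianReal 0 1) = ∫ x, g' x ∂(gaussianReal 0 1) := by
  have hgc : Continuous g := continuous_iff_continuousAt.2 fun x => (hd x).continuousAt
  have i1 : Integrable g (gaussianReal 0 1) :=
    (integrable_const C).mono' hgc.aestronglyMeasurable (ae_of_all _ hC)
  have i2 : Integrable g' (gaussianReal 0 1) :=
    (integrable_const C).mono' hg'.aestronglyMeasurable (ae_of_all _ hC')
  have i3 : Integrable (fun x => g x * x) (gaussianReal 0 1) :=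
    integrable_id_gaussian.bdd_mul hgc.aestronglyMeasurable (ae_of_all _ hC)
  have key := integral_mul_deriv_eq_deriv_mul_of_integrable (u := g) (u' := g')
    (v := gaussianPDFReal 0 1) (v' := fun x => -(x * gaussianPDFReal 0 1 x))
    (fun x _ => hd x) (fun x _ => hasDerivAt_gaussianPDFReal x)
    (((integrable_mul_gaussianPDFReal i3).neg).congr (ae_of_all _ fun x => by simp; ring))
    (integrable_mul_gaussianPDFReal i2) (integrable_mul_gaussianPDFReal i1)
  rw [integral_gaussian_eq, integral_gaussian_eq, ← neg_inj, ← key, ← integral_neg]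
  exact integral_congr_ae (ae_of_all _ fun x => by simp; ring)

/-! ### Integration by parts under the product Gaussian measure. -/

section pi

variable {ι : Type*} [Fintype ι]

theorem integrable_eval_stdPi (k : ι) : Integrable (fun w : ι → ℝ => w k) (stdPi ι) :=
  (measurePreserving_eval (fun _ : ι => gaussianReal 0 1) k).integrable_comp_of_integrable
    integrable_id_gaussian

variable [DecidableEq ι]

/-- Resampling one coordinate independently keeps the product law. This is Fubini in a form that
isolates coordinate `k` without changing the index type. -/
theorem measurePreserving_update (k : ι) :
    MeasurePreserving (fun q : (ι → ℝ) × ℝ => Function.update q.1 k q.2)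
      ((stdPi ι).prod (gaussianReal 0 1)) (stdPi ι) := by
  have hm : Measurable (fun q : (ι → ℝ) × ℝ => Function.update q.1 k q.2) := by
    refine measurable_pi_lambda _ fun i => ?_
    by_cases h : i = k
    · subst h; simpa using measurable_snd
    · simp only [Function.update_of_ne h]
      exact (measurable_pi_apply i).comp measurable_fst
  refine ⟨hm, (Measure.pi_eq fun s hs => ?_).symm⟩
  rw [Measure.map_apply hm (MeasurableSet.univ_pi hs)]
  have : (fun q : (ι → ℝ) × ℝ => Function.update q.1 k q.2) ⁻¹' (univ.pi s) =
      (univ.pi (Function.update s k univ)) ×ˢ (s k) := by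
    ext ⟨w, x⟩
    simp only [mem_preimage, Set.mem_pi, mem_univ, forall_true_left, mem_prod]
    constructor
    · intro h
      refine ⟨fun i => ?_, by simpa using h k⟩
      by_cases hi : i = k
      · subst hi; simp
      · simpa [Function.update_of_ne hi] using h i
    · rintro ⟨h1, h2⟩ i
      by_cases hi : i = k
      · subst hi; simpa using h2
      · simpa [Function.update_of_ne hi] using h1 i
  rw [this, Measure.prod_prod, Measure.pi_pi,
    ← Finset.mul_prod_erase Finset.univ _ (Finset.mem_univ k),
    ← Finset.mul_prod_erase Finset.univ (fun i => (gaussianReal 0 1) (s i)) (Finset.mem_univ k)]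
  simp only [Function.update_self, measure_univ, one_mul]
  rw [mul_comm]
  congr 1
  refine Finset.prod_congr rfl fun i hi => ?_
  rw [Function.update_of_ne (Finset.ne_of_mem_erase hi)]

/-- Gaussian integration by parts in one coordinate. -/
theorem integral_eval_mul_stdPi (k : ι) {G G' : (ι → ℝ) → ℝ} {C : ℝ}
    (hd : ∀ w s, HasDerivAt (fun s => G (Function.update w k s)) (G' (Function.update w k s)) s)
    (hG : Continuous G) (hG' : Continuous G') (hC : ∀ x, |G x| ≤ C) (hC' : ∀ x, |G' x| ≤ C) :
    ∫ w, w k * G w ∂(stdPi ι) = ∫ w, G' w ∂(stdPi ι) := by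
  have mp := measurePreserving_update k
  have i1 : Integrable (fun w => w k * G w) (stdPi ι) := by
    simpa [mul_comm] using (integrable_eval_stdPi k).bdd_mul hG.aestronglyMeasurable (ae_of_all _ hC)
  have i2 : Integrable G' (stdPi ι) :=
    (integrable_const C).mono' hG'.aestronglyMeasurable (ae_of_all _ hC')
  have e1 : ∀ F : (ι → ℝ) → ℝ, Integrable F (stdPi ι) → ∫ w, F w ∂(stdPi ι) =
      ∫ w, ∫ s, F (Function.update w k s) ∂(gaussianReal 0 1) ∂(stdPi ι) := by
    intro F hF
    have hF' := mp.integrable_comp_of_integrable hF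
    rw [← integral_prod (fun q : (ι → ℝ) × ℝ => F (Function.update q.1 k q.2)) hF']
    conv_lhs => rw [← mp.map_eq]
    rw [integral_map mp.measurable.aemeasurable (by rw [mp.map_eq]; exact hF.aestronglyMeasurable)]
  rw [e1 _ i1, e1 _ i2]
  refine integral_congr_ae (ae_of_all _ fun w => ?_)
  have hc : Continuous fun s : ℝ => Function.update w k s := continuous_const.update k continuous_id
  simp only [Function.update_self]
  exact integral_mul_gaussian (hd w) (hG'.comp hc) (fun s => hC _) (fun s => hC' _)

end pi

/-! ### Gaussian interpolation and Kahane's comparison. -/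

section interpolation

variable {ι : Type*} [Fintype ι] {E : Type*} [NormedAddCommGroup E] [NormedSpace ℝ E]

/-- The Gaussian vector interpolating between `∑ w p • B p` at `θ = 0` and `∑ w p • A p` at
`θ = π / 2`. -/
noncomputable def interp (A B : ι → E) (θ : ℝ) (w : ι → ℝ) : E :=
  ∑ p, w p • (Real.sin θ • A p + Real.cos θ • B p)

theorem continuous_interp (A B : ι → E) (θ : ℝ) : Continuous (interp A B θ) := by
  unfold interp; fun_prop

/-- The derivative of `interp` in `θ`. -/
noncomputable def interpDeriv (A B : ι → E) (θ : ℝ) (w : ι → ℝ) : E :=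
  ∑ p, w p • (Real.cos θ • A p - Real.sin θ • B p)

theorem continuous_interpDeriv (A B : ι → E) (θ : ℝ) : Continuous (interpDeriv A B θ) := by
  unfold interpDeriv; fun_prop

theorem hasDerivAt_interp (A B : ι → E) (θ : ℝ) (w : ι → ℝ) :
    HasDerivAt (fun θ => interp A B θ w) (interpDeriv A B θ w) θ := by
  unfold interp interpDeriv
  refine HasDerivAt.fun_sum fun p _ => HasDerivAt.const_smul _ ?_
  have := ((Real.hasDerivAt_sin θ).smul_const (A p)).fun_add ((Real.hasDerivAt_cos θ).smul_const (B p))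
  simpa [sub_eq_add_neg] using this

theorem norm_interpDeriv_le (A B : ι → E) (θ : ℝ) (w : ι → ℝ) :
    ‖interpDeriv A B θ w‖ ≤ ∑ p, |w p| * (‖A p‖ + ‖B p‖) := by
  refine (norm_sum_le _ _).trans (Finset.sum_le_sum fun p _ => ?_)
  rw [norm_smul, Real.norm_eq_abs]
  gcongr
  refine (norm_sub_le _ _).trans ?_
  rw [norm_smul, norm_smul, Real.norm_eq_abs, Real.norm_eq_abs]
  gcongr
  · exact mul_le_of_le_one_left (norm_nonneg _) (Real.abs_cos_le_one θ)
  · exact mul_le_of_le_one_left (norm_nonneg _) (Real.abs_sin_le_one θ)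

theorem hasDerivAt_interp_update [DecidableEq ι] (A B : ι → E) (θ : ℝ) (w : ι → ℝ) (k : ι)
    (s : ℝ) : HasDerivAt (fun s => interp A B θ (Function.update w k s))
      (Real.sin θ • A k + Real.cos θ • B k) s := by
  unfold interp
  have h : ∀ p, HasDerivAt
      (fun s => Function.update w k s p • (Real.sin θ • A p + Real.cos θ • B p))
      (if p = k then Real.sin θ • A k + Real.cos θ • B k else 0) s := by
    intro p
    by_cases hp : p = k
    · subst hp
      simpa using (hasDerivAt_id s).smul_const (Real.sin θ • A p + Real.cos θ • B p)
    · simpa [Function.update_of_ne hp, hp] using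
        hasDerivAt_const s (w p • (Real.sin θ • A p + Real.cos θ • B p))
  simpa using HasDerivAt.fun_sum fun p (_ : p ∈ Finset.univ) => h p

/-- Differentiation under the integral: `fderiv ℝ f` is bounded and the sine and cosine are at most
`1` in absolute value, so a fixed linear combination of the integrable `|w p|` dominates for every
`θ`. -/
theorem hasDerivAt_integral_interp {f : E → ℝ} (hf : ContDiff ℝ 2 f) {C : ℝ}
    (h0 : ∀ z, |f z| ≤ C) (h1 : ∀ z, ‖fderiv ℝ f z‖ ≤ C) (A B : ι → E) (θ : ℝ) :
    HasDerivAt (fun θ => ∫ w, f (interp A B θ w) ∂(stdPi ι))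
      (∫ w, fderiv ℝ f (interp A B θ w) (interpDeriv A B θ w) ∂(stdPi ι)) θ := by
  have hC : 0 ≤ C := (norm_nonneg _).trans (h1 0)
  have c1 : Continuous (fderiv ℝ f) := hf.continuous_fderiv (by norm_num)
  refine (hasDerivAt_integral_of_dominated_loc_of_deriv_le
    (F := fun θ w => f (interp A B θ w))
    (F' := fun θ w => fderiv ℝ f (interp A B θ w) (interpDeriv A B θ w))
    (bound := fun w => C * ∑ p, |w p| * (‖A p‖ + ‖B p‖)) univ_mem ?_ ?_ ?_ ?_ ?_ ?_).2
  · exact Eventually.of_forall fun θ =>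
      (hf.continuous.comp (continuous_interp A B θ)).aestronglyMeasurable
  · exact (integrable_const C).mono'
      (hf.continuous.comp (continuous_interp A B θ)).aestronglyMeasurable
      (ae_of_all _ fun w => h0 _)
  · exact ((c1.comp (continuous_interp A B θ)).clm_apply
      (continuous_interpDeriv A B θ)).aestronglyMeasurable
  · refine ae_of_all _ fun w θ _ => (ContinuousLinearMap.le_opNorm _ _).trans ?_
    exact mul_le_mul (h1 _) (norm_interpDeriv_le A B θ w) (norm_nonneg _) hC
  · refine (integrable_finsetSum _ fun p _ => ?_).const_mul C
    exact (integrable_eval_stdPi p).abs.mul_const _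
  · refine ae_of_all _ fun w θ _ => ?_
    exact ((hf.differentiable (by norm_num)) _).hasFDerivAt.comp_hasDerivAt θ
      (hasDerivAt_interp A B θ w)

/-- The velocity `interpDeriv` is linear in `w`; integrating by parts in each `w p` trades that
factor for a derivative of `f` in the direction `sin θ • A p + cos θ • B p`, so only the Hessian
remains. -/
theorem integral_fderiv_interp {f : E → ℝ} (hf : ContDiff ℝ 2 f) {C : ℝ}
    (h1 : ∀ z, ‖fderiv ℝ f z‖ ≤ C) (h2 : ∀ z, ‖fderiv ℝ (fderiv ℝ f) z‖ ≤ C)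
    (A B : ι → E) (θ : ℝ) :
    ∫ w, fderiv ℝ f (interp A B θ w) (interpDeriv A B θ w) ∂(stdPi ι) =
      ∫ w, ∑ p, fderiv ℝ (fderiv ℝ f) (interp A B θ w) (Real.sin θ • A p + Real.cos θ • B p)
        (Real.cos θ • A p - Real.sin θ • B p) ∂(stdPi ι) := by
  classical
  have hC : 0 ≤ C := (norm_nonneg _).trans (h1 0)
  have c1 : Continuous (fderiv ℝ f) := hf.continuous_fderiv (by norm_num)
  have hf1 : ContDiff ℝ 1 (fderiv ℝ f) := hf.fderiv_right (by norm_num)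
  have c2 : Continuous (fderiv ℝ (fderiv ℝ f)) := hf1.continuous_fderiv (by norm_num)
  have ci := continuous_interp A B θ
  set a : ι → E := fun p => Real.sin θ • A p + Real.cos θ • B p
  set b : ι → E := fun p => Real.cos θ • A p - Real.sin θ • B p
  have e : ∀ w, fderiv ℝ f (interp A B θ w) (interpDeriv A B θ w) =
      ∑ p, w p * fderiv ℝ f (interp A B θ w) (b p) := by
    intro w
    simp [interpDeriv, b, map_sum]
  simp_rw [e]
  have cb : ∀ p, Continuous fun w => fderiv ℝ f (interp A B θ w) (b p) := fun p =>
    (c1.comp ci).clm_apply continuous_const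
  have cab : ∀ p, Continuous fun w => fderiv ℝ (fderiv ℝ f) (interp A B θ w) (a p) (b p) :=
    fun p => ((c2.comp ci).clm_apply continuous_const).clm_apply continuous_const
  have bb : ∀ p w, |fderiv ℝ f (interp A B θ w) (b p)| ≤ C * ‖b p‖ := fun p w =>
    (ContinuousLinearMap.le_opNorm (fderiv ℝ f (interp A B θ w)) (b p)).trans
      (mul_le_mul_of_nonneg_right (h1 _) (norm_nonneg _))
  have bab : ∀ p w, |fderiv ℝ (fderiv ℝ f) (interp A B θ w) (a p) (b p)| ≤
      C * ‖a p‖ * ‖b p‖ := fun p w =>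
    (ContinuousLinearMap.le_opNorm₂ (fderiv ℝ (fderiv ℝ f) (interp A B θ w)) (a p) (b p)).trans
      (mul_le_mul_of_nonneg_right (mul_le_mul_of_nonneg_right (h2 _) (norm_nonneg _))
        (norm_nonneg _))
  rw [integral_finsetSum, integral_finsetSum]
  · refine Finset.sum_congr rfl fun p _ => ?_
    refine integral_eval_mul_stdPi p (C := max (C * ‖b p‖) (C * ‖a p‖ * ‖b p‖)) ?_ (cb p) (cab p)
      (fun w => (bb p w).trans (le_max_left _ _)) (fun w => (bab p w).trans (le_max_right _ _))
    intro w s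
    have := (((hf1.differentiable (by norm_num)) _).hasFDerivAt.comp_hasDerivAt s
      (hasDerivAt_interp_update A B θ w p s))
    simpa [b] using this.clm_apply (hasDerivAt_const s (b p))
  · exact fun p _ => (integrable_const _).mono' (cab p).aestronglyMeasurable (ae_of_all _ (bab p))
  · intro p _
    simpa [mul_comm] using
      (integrable_eval_stdPi p).bdd_mul (cb p).aestronglyMeasurable (ae_of_all _ (bb p))

/-- Kahane's Gaussian comparison inequality for two independent linear images of a standard
Gaussian vector. -/
theorem gaussian_comparison {f : E → ℝ} (hf : ContDiff ℝ 2 f) {C : ℝ}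
    (h0 : ∀ z, |f z| ≤ C) (h1 : ∀ z, ‖fderiv ℝ f z‖ ≤ C) (h2 : ∀ z, ‖fderiv ℝ (fderiv ℝ f) z‖ ≤ C)
    (A B : ι → E) (hAB : ∀ p, A p = 0 ∨ B p = 0)
    (hpos : ∀ z, ∑ p, fderiv ℝ (fderiv ℝ f) z (B p) (B p) ≤
      ∑ p, fderiv ℝ (fderiv ℝ f) z (A p) (A p)) :
    ∫ w, f (∑ p, w p • B p) ∂(stdPi ι) ≤ ∫ w, f (∑ p, w p • A p) ∂(stdPi ι) := by
  have hd := hasDerivAt_integral_interp hf h0 h1 A B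
  have hm : MonotoneOn (fun θ => ∫ w, f (interp A B θ w) ∂(stdPi ι)) (Icc 0 (Real.pi / 2)) := by
    refine monotoneOn_of_deriv_nonneg (convex_Icc _ _)
      (fun θ _ => (hd θ).continuousAt.continuousWithinAt)
      (fun θ _ => (hd θ).differentiableAt.differentiableWithinAt) fun θ hθ => ?_
    rw [interior_Icc] at hθ
    rw [(hd θ).deriv, integral_fderiv_interp hf h1 h2]
    refine integral_nonneg fun w => ?_
    -- No `p` contributes to both processes, so the cross terms in `A p` and `B p` vanish and the
    -- trigonometric factors pull out.
    have e : ∀ p, fderiv ℝ (fderiv ℝ f) (interp A B θ w) (Real.sin θ • A p + Real.cos θ • B p)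
        (Real.cos θ • A p - Real.sin θ • B p) = Real.sin θ * Real.cos θ *
        (fderiv ℝ (fderiv ℝ f) (interp A B θ w) (A p) (A p) -
          fderiv ℝ (fderiv ℝ f) (interp A B θ w) (B p) (B p)) := by
      intro p
      rcases hAB p with h | h <;> simp only [h, map_zero, smul_zero, zero_add, add_zero, zero_sub,
        sub_zero, map_neg, map_smul, _root_.smul_apply,
        smul_eq_mul] <;> ring
    simp only [e, Pi.zero_apply, ← Finset.mul_sum, Finset.sum_sub_distrib]
    have s1 : 0 ≤ Real.sin θ :=
      Real.sin_nonneg_of_nonneg_of_le_pi hθ.1.le (by linarith [hθ.2, Real.pi_pos])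
    have s2 : 0 ≤ Real.cos θ := Real.cos_nonneg_of_mem_Icc ⟨by linarith [hθ.1, Real.pi_pos], hθ.2.le⟩
    exact mul_nonneg (mul_nonneg s1 s2) (sub_nonneg.2 (hpos _))
  have hp : (0 : ℝ) ≤ Real.pi / 2 := by positivity
  simpa [interp] using hm (left_mem_Icc.2 hp) (right_mem_Icc.2 hp) hp

end interpolation

/-! ### Functions bounded together with two derivatives. -/

section bounded

variable {E : Type*} [NormedAddCommGroup E] [NormedSpace ℝ E]

/-- A `C²` function that is bounded together with its first two derivatives. -/
structure IsBddC2 (f : E → ℝ) : Prop where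
  contDiff : ContDiff ℝ 2 f
  bdd : ∃ C, ∀ i ≤ 2, ∀ x, ‖iteratedFDeriv ℝ i f x‖ ≤ C

theorem IsBddC2.const_sub {f : E → ℝ} (hf : IsBddC2 f) (c : ℝ) : IsBddC2 fun x => c - f x := by
  obtain ⟨C, hC⟩ := hf.bdd
  refine ⟨contDiff_const.sub hf.contDiff, |c| + C, fun i hi x => ?_⟩
  rcases Nat.eq_zero_or_pos i with rfl | h
  · simp only [norm_iteratedFDeriv_zero] at hC ⊢
    have := hC 0 hi x
    rw [norm_iteratedFDeriv_zero] at this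
    exact (norm_sub_le _ _).trans (add_le_add le_rfl this)
  · obtain ⟨j, rfl⟩ : ∃ j, i = j + 1 := ⟨i - 1, by omega⟩
    have e : fderiv ℝ (fun x => c - f x) = -fderiv ℝ f := by
      ext1 x; simp [fderiv_const_sub]
    rw [← norm_iteratedFDeriv_fderiv, e, iteratedFDeriv_neg_apply, norm_neg,
      norm_iteratedFDeriv_fderiv]
    exact (hC _ hi x).trans (le_add_of_nonneg_left (abs_nonneg c))

theorem IsBddC2.mul {f g : E → ℝ} (hf : IsBddC2 f) (hg : IsBddC2 g) :
    IsBddC2 fun x => f x * g x := by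
  obtain ⟨C, hC⟩ := hf.bdd
  obtain ⟨D, hD⟩ := hg.bdd
  have hC0 : 0 ≤ C := (norm_nonneg _).trans (hC 0 (by norm_num) 0)
  -- The Leibniz formula up to order two has at most three terms, with binomial coefficients at most
  -- `2`.
  refine ⟨hf.contDiff.mul hg.contDiff, ∑ i ∈ Finset.range 3, (2 : ℝ) * C * D, fun i hi x => ?_⟩
  refine (norm_iteratedFDeriv_mul_le hf.contDiff hg.contDiff x (by exact_mod_cast hi)).trans ?_
  have hD0 : 0 ≤ D := (norm_nonneg _).trans (hD 0 (by norm_num) 0)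
  refine (Finset.sum_le_sum (g := fun _ => 2 * C * D) fun k hk => ?_).trans
    (Finset.sum_le_sum_of_subset_of_nonneg (Finset.range_subset_range.2 (by omega))
      fun _ _ _ => by positivity)
  have hk' := Finset.mem_range.1 hk
  have hch : ((i.choose k : ℕ) : ℝ) ≤ 2 := by
    have : i.choose k ≤ 2 := by interval_cases i <;> interval_cases k <;> decide
    exact_mod_cast this
  gcongr
  · exact hC k (by omega) x
  · exact hD (i - k) (by omega) x

theorem IsBddC2.const (c : ℝ) : IsBddC2 fun _ : E => c := by
  refine ⟨contDiff_const, |c|, fun i _ x => ?_⟩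
  rcases Nat.eq_zero_or_pos i with rfl | h
  · simp
  · rw [iteratedFDeriv_const_of_ne (by omega)]; simp

theorem IsBddC2.prod {J : Type*} (s : Finset J) {f : J → E → ℝ} (hf : ∀ j, IsBddC2 (f j)) :
    IsBddC2 fun x => ∏ j ∈ s, f j x := by
  classical
  induction s using Finset.induction_on with
  | empty => simpa using IsBddC2.const (E := E) 1
  | insert a s ha ih => simpa [Finset.prod_insert ha] using (hf a).mul ih

theorem IsBddC2.comp_clm {φ : ℝ → ℝ} (hφ : IsBddC2 φ) (L : E →L[ℝ] ℝ) :
    IsBddC2 fun x => φ (L x) := by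
  obtain ⟨C, hC⟩ := hφ.bdd
  have hC0 : 0 ≤ C := (norm_nonneg _).trans (hC 0 (by norm_num) 0)
  refine ⟨hφ.contDiff.comp L.contDiff, C * (1 + ‖L‖) ^ 2, fun i hi x => ?_⟩
  have e := L.iteratedFDeriv_comp_right hφ.contDiff x (i := i) (by exact_mod_cast hi)
  change ‖iteratedFDeriv ℝ i (φ ∘ L) x‖ ≤ _
  rw [e]
  refine (ContinuousMultilinearMap.norm_compContinuousLinearMap_le _ _).trans ?_
  rw [Finset.prod_const, Finset.card_fin]
  refine mul_le_mul (hC i hi _) ?_ (by positivity) hC0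
  exact (pow_le_pow_left₀ (norm_nonneg _) (by linarith) i).trans
    (pow_le_pow_right₀ (by linarith [norm_nonneg L]) hi)

end bounded

/-! ### Smooth indicators of the minmax event. -/

/-- A smooth nondecreasing step from `0` at `l` to `1` at `l + ε`. -/
noncomputable def smoothStep (l ε s : ℝ) : ℝ :=
  Real.smoothTransition ((s - l) / ε)

/-- The step is constant outside `[l, l + ε]`, so its derivatives are continuous with compact
support. -/
theorem isBddC2_smoothStep (l : ℝ) {ε : ℝ} (hε : 0 < ε) : IsBddC2 (smoothStep l ε) := by
  have hc : ContDiff ℝ 2 (smoothStep l ε) :=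
    Real.smoothTransition.contDiff.comp ((contDiff_id.sub contDiff_const).div_const ε)
  have hs : HasCompactSupport (deriv (smoothStep l ε)) := by
    refine HasCompactSupport.intro (isCompact_Icc (a := l) (b := l + ε)) fun x hx => ?_
    rw [mem_Icc, not_and_or, not_le, not_le] at hx
    rcases hx with h | h
    · have : smoothStep l ε =ᶠ[𝓝 x] fun _ => 0 := by
        filter_upwards [gt_mem_nhds h] with y hy
        exact Real.smoothTransition.zero_of_nonpos
          (div_nonpos_of_nonpos_of_nonneg (by linarith) hε.le)
      rw [this.deriv_eq, deriv_const]
    · have : smoothStep l ε =ᶠ[𝓝 x] fun _ => 1 := by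
        filter_upwards [lt_mem_nhds h] with y hy
        exact Real.smoothTransition.one_of_one_le ((one_le_div hε).2 (by linarith))
      rw [this.deriv_eq, deriv_const]
  have hc1 : ContDiff ℝ 1 (deriv (smoothStep l ε)) := by
    have := hc; rw [show (2 : WithTop ℕ∞) = 1 + 1 by norm_num, contDiff_succ_iff_deriv] at this
    exact this.2.2
  obtain ⟨C1, h1⟩ := hs.exists_bound_of_continuous hc1.continuous
  obtain ⟨C2, h2⟩ := hs.deriv.exists_bound_of_continuous (hc1.continuous_deriv le_rfl)
  refine ⟨hc, max 1 (max C1 C2), fun i hi x => ?_⟩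
  rw [norm_iteratedFDeriv_eq_norm_iteratedDeriv]
  interval_cases i
  · rw [iteratedDeriv_zero, Real.norm_eq_abs, smoothStep, abs_of_nonneg (Real.smoothTransition.nonneg _)]
    exact (Real.smoothTransition.le_one _).trans (le_max_left _ _)
  · rw [iteratedDeriv_one]
    exact (h1 x).trans ((le_max_left _ _).trans (le_max_right _ _))
  · rw [iteratedDeriv_succ, iteratedDeriv_one]
    exact (h2 x).trans ((le_max_right _ _).trans (le_max_right _ _))

section gordon

theorem monotone_smoothStep (l : ℝ) {ε : ℝ} (hε : 0 < ε) : Monotone (smoothStep l ε) :=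
  fun _ _ h => Real.smoothTransition.monotone (by gcongr)

variable {X Y : Type*} [Fintype Y]

/-- A smooth version of the indicator that `max_y z (x, y)` exceeds `l`. -/
noncomputable def smoothMax (l ε : ℝ) (x : X) (z : X × Y → ℝ) : ℝ :=
  1 - ∏ y, (1 - smoothStep l ε (z (x, y)))

theorem one_sub_smoothStep_mem (l ε s : ℝ) : 1 - smoothStep l ε s ∈ Icc (0 : ℝ) 1 :=
  ⟨sub_nonneg.2 (Real.smoothTransition.le_one _),
    sub_le_self _ (Real.smoothTransition.nonneg _)⟩

theorem smoothMax_mem (l ε : ℝ) (x : X) (z : X × Y → ℝ) : smoothMax l ε x z ∈ Icc (0 : ℝ) 1 := by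
  have h0 : 0 ≤ ∏ y, (1 - smoothStep l ε (z (x, y))) :=
    Finset.prod_nonneg fun y _ => (one_sub_smoothStep_mem _ _ _).1
  have h1 : ∏ y, (1 - smoothStep l ε (z (x, y))) ≤ 1 :=
    Finset.prod_le_one (fun y _ => (one_sub_smoothStep_mem _ _ _).1)
      fun y _ => (one_sub_smoothStep_mem _ _ _).2
  exact ⟨sub_nonneg.2 h1, sub_le_self _ h0⟩

theorem monotone_smoothMax (l : ℝ) {ε : ℝ} (hε : 0 < ε) (x : X) :
    Monotone (smoothMax (Y := Y) l ε x) := fun _ _ h =>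
  sub_le_sub_left (Finset.prod_le_prod (fun _ _ => (one_sub_smoothStep_mem _ _ _).1)
    fun _ _ => sub_le_sub_left (monotone_smoothStep l hε (h _)) 1) 1

theorem smoothMax_add_single [DecidableEq X] [DecidableEq Y] (l ε : ℝ) {x x' : X}
    (h : x ≠ x') (y : Y) (z : X × Y → ℝ) (t : ℝ) :
    smoothMax l ε x (z + t • Pi.single (x', y) 1) = smoothMax l ε x z := by
  simp [smoothMax, h]

variable [Fintype X]

/-- A smooth version of the indicator that `min_x max_y z (x, y)` exceeds `l`. -/
noncomputable def smoothMinMax (l ε : ℝ) (z : X × Y → ℝ) : ℝ :=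
  ∏ x, smoothMax l ε x z

theorem isBddC2_smoothMax (l : ℝ) {ε : ℝ} (hε : 0 < ε) (x : X) :
    IsBddC2 (smoothMax (Y := Y) l ε x) := by
  refine IsBddC2.const_sub (IsBddC2.prod _ fun y => IsBddC2.const_sub ?_ 1) 1
  exact (isBddC2_smoothStep l hε).comp_clm (ContinuousLinearMap.proj (R := ℝ) (φ := fun _ : X × Y => ℝ) (x, y))

theorem isBddC2_smoothMinMax (l : ℝ) {ε : ℝ} (hε : 0 < ε) :
    IsBddC2 (smoothMinMax (X := X) (Y := Y) l ε) :=
  IsBddC2.prod _ fun x => isBddC2_smoothMax l hε x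

theorem smoothMinMax_mem (l ε : ℝ) (z : X × Y → ℝ) : smoothMinMax l ε z ∈ Icc (0 : ℝ) 1 :=
  ⟨Finset.prod_nonneg fun x _ => (smoothMax_mem l ε x z).1,
    Finset.prod_le_one (fun x _ => (smoothMax_mem l ε x z).1) fun x _ => (smoothMax_mem l ε x z).2⟩

theorem smoothMinMax_eq_one {l ε : ℝ} (hε : 0 < ε) {z : X × Y → ℝ}
    (h : ∀ x, ∃ y, l + ε ≤ z (x, y)) : smoothMinMax l ε z = 1 := by
  refine Finset.prod_eq_one fun x _ => ?_
  obtain ⟨y, hy⟩ := h x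
  have : smoothStep l ε (z (x, y)) = 1 :=
    Real.smoothTransition.one_of_one_le ((one_le_div hε).2 (by linarith))
  rw [smoothMax, Finset.prod_eq_zero (Finset.mem_univ y) (by rw [this, sub_self]), sub_zero]

theorem smoothMinMax_eq_zero {l ε : ℝ} (hε : 0 < ε) {z : X × Y → ℝ}
    (h : ¬ ∀ x, ∃ y, l < z (x, y)) : smoothMinMax l ε z = 0 := by
  push Not at h
  obtain ⟨x, hx⟩ := h
  refine Finset.prod_eq_zero (Finset.mem_univ x) ?_
  rw [smoothMax, Finset.prod_eq_one fun y _ => ?_, sub_self]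
  rw [smoothStep, Real.smoothTransition.zero_of_nonpos, sub_zero]
  exact div_nonpos_of_nonpos_of_nonneg (by linarith [hx y]) hε.le

variable [DecidableEq X] [DecidableEq Y]

/-- Coordinates with different `x` enter different factors of the product. The mixed derivative is
therefore a product of two first derivatives of nondecreasing functions and of the remaining
nonnegative factors. Within one `x` no sign is claimed, which is why Gordon's hypotheses ask for
equal covariances there. -/
theorem fderiv_fderiv_smoothMinMax_nonneg (l : ℝ) {ε : ℝ} (hε : 0 < ε) (z : X × Y → ℝ)
    {i j : X × Y} (hij : i.1 ≠ j.1) :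
    0 ≤ fderiv ℝ (fderiv ℝ (smoothMinMax l ε)) z (Pi.single i 1) (Pi.single j 1) := by
  obtain ⟨x, y⟩ := i
  obtain ⟨x', y'⟩ := j
  replace hij : x ≠ x' := hij
  set e : X × Y → ℝ := Pi.single (x, y) 1
  set e' : X × Y → ℝ := Pi.single (x', y') 1
  set f : (X × Y → ℝ) → ℝ := smoothMinMax l ε
  have hf : ContDiff ℝ 2 f := (isBddC2_smoothMinMax l hε).contDiff
  have hf1 : ContDiff ℝ 1 (fderiv ℝ f) := hf.fderiv_right (by norm_num)
  have hline : ∀ (v z : X × Y → ℝ) (t : ℝ), HasDerivAt (fun t : ℝ => z + t • v) v t := by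
    intro v z t
    simpa using ((hasDerivAt_id t).smul_const v).const_add z
  have hdP : ∀ (a : X) (v z : X × Y → ℝ) (t : ℝ),
      DifferentiableAt ℝ (fun t : ℝ => smoothMax l ε a (z + t • v)) t := fun a v z t =>
    (((isBddC2_smoothMax l hε a).contDiff.differentiable (by norm_num)) _).comp t
      (hline v z t).differentiableAt
  set c : ℝ := ∏ a ∈ (Finset.univ.erase x).erase x', smoothMax l ε a z
  have hc : 0 ≤ c := Finset.prod_nonneg fun a _ => (smoothMax_mem l ε a z).1
  set p : ℝ → ℝ := fun t => smoothMax l ε x' (z + t • e')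
  set q : ℝ → ℝ := fun s => smoothMax l ε x (z + s • e)
  have hmono : ∀ a (i : X × Y), Monotone fun t : ℝ => smoothMax l ε a (z + t • Pi.single i (1 : ℝ)) :=
    fun a i s t hst => monotone_smoothMax l hε a (by gcongr; simp)
  have hfac : ∀ s t, f (z + s • e + t • e') = c * q s * p t := by
    intro s t
    have hx' : x' ∈ Finset.univ.erase x := Finset.mem_erase.2 ⟨hij.symm, Finset.mem_univ _⟩
    change ∏ a, _ = _
    rw [← Finset.mul_prod_erase _ _ (Finset.mem_univ x), ← Finset.mul_prod_erase _ _ hx']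
    have e1 : smoothMax l ε x (z + s • e + t • e') = q s := smoothMax_add_single l ε hij _ _ _
    have e2 : smoothMax l ε x' (z + s • e + t • e') = p t := by
      rw [add_right_comm]; exact smoothMax_add_single l ε hij.symm _ _ _
    have e3 : ∏ a ∈ (Finset.univ.erase x).erase x', smoothMax l ε a (z + s • e + t • e') = c := by
      refine Finset.prod_congr rfl fun a ha => ?_
      simp only [Finset.mem_erase] at ha
      rw [smoothMax_add_single l ε ha.1, smoothMax_add_single l ε ha.2.1]
    rw [e1, e2, e3]; ring
  have h1 : ∀ s, fderiv ℝ f (z + s • e) e' = c * q s * deriv p 0 := by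
    intro s
    have a1 := ((hf.differentiable (by norm_num)) (z + s • e + (0 : ℝ) • e')).hasFDerivAt.comp_hasDerivAt
      0 (hline e' (z + s • e) 0)
    have a2 : HasDerivAt (fun t => c * q s * p t) (c * q s * deriv p 0) 0 :=
      (hdP x' e' z 0).hasDerivAt.const_mul _
    have : (f ∘ fun t : ℝ => z + s • e + t • e') = fun t => c * q s * p t := funext (hfac s)
    rw [this] at a1
    simpa using a1.unique a2
  have h2 : fderiv ℝ (fderiv ℝ f) z e e' = c * deriv q 0 * deriv p 0 := by
    have a1 := ((hf1.differentiable (by norm_num)) (z + (0 : ℝ) • e)).hasFDerivAt.comp_hasDerivAt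
      0 (hline e z 0)
    have a3 := a1.clm_apply (hasDerivAt_const 0 e')
    have a2 : HasDerivAt (fun s => c * q s * deriv p 0) (c * deriv q 0 * deriv p 0) 0 :=
      ((hdP x e z 0).hasDerivAt.const_mul _).mul_const _
    simp only [Function.comp_apply, h1] at a3
    simpa using a3.unique a2
  rw [h2]
  exact mul_nonneg (mul_nonneg hc (hmono x (x, y)).deriv_nonneg) (hmono x' (x', y')).deriv_nonneg

theorem apply_apply_eq_sum {I : Type*} [Fintype I] [DecidableEq I]
    (D : (I → ℝ) →L[ℝ] (I → ℝ) →L[ℝ] ℝ) (v : I → ℝ) :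
    D v v = ∑ i, ∑ j, v i * v j * D (Pi.single i 1) (Pi.single j 1) := by
  have hv : v = ∑ i, v i • (Pi.single i 1 : I → ℝ) := by
    ext k; simp [Finset.sum_apply, Pi.single_apply]
  conv_lhs => rw [hv]
  simp only [map_sum, map_smul, FunLike.coe_sum, Finset.sum_apply,
    _root_.smul_apply, smul_eq_mul, Finset.mul_sum]
  rw [Finset.sum_comm]
  exact Finset.sum_congr rfl fun i _ => Finset.sum_congr rfl fun j _ => by ring

variable {ι : Type*} [Fintype ι]

/-- Expanding the Hessian in coordinates gives the sum of covariance times `∂ᵢ∂ⱼ`. Pairs sharing `x`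
contribute equally on both sides; for the others the larger covariance multiplies a nonnegative
derivative. -/
theorem integral_smoothMinMax_le (l : ℝ) {ε : ℝ} (hε : 0 < ε) (A B : ι → X × Y → ℝ)
    (hAB : ∀ p, A p = 0 ∨ B p = 0)
    (heq : ∀ x y y', ∑ p, B p (x, y) * B p (x, y') = ∑ p, A p (x, y) * A p (x, y'))
    (hle : ∀ i j, ∑ p, B p i * B p j ≤ ∑ p, A p i * A p j) :
    ∫ w, smoothMinMax l ε (∑ p, w p • B p) ∂(stdPi ι) ≤
      ∫ w, smoothMinMax l ε (∑ p, w p • A p) ∂(stdPi ι) := by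
  have hb := isBddC2_smoothMinMax (X := X) (Y := Y) l hε
  obtain ⟨C, hC⟩ := hb.bdd
  refine gaussian_comparison hb.contDiff (C := C) (fun z => ?_) (fun z => ?_) (fun z => ?_) A B hAB
    fun z => ?_
  · simpa [norm_iteratedFDeriv_zero] using hC 0 (by norm_num) z
  · simpa [norm_iteratedFDeriv_one] using hC 1 (by norm_num) z
  · have := hC 2 le_rfl z
    rwa [← norm_iteratedFDeriv_fderiv, norm_iteratedFDeriv_one] at this
  · simp only [apply_apply_eq_sum]
    rw [Finset.sum_comm, Finset.sum_comm (s := Finset.univ (α := ι))]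
    refine Finset.sum_le_sum fun i _ => ?_
    rw [Finset.sum_comm, Finset.sum_comm (s := Finset.univ (α := ι))]
    refine Finset.sum_le_sum fun j _ => ?_
    rw [← Finset.sum_mul, ← Finset.sum_mul]
    by_cases hij : i.1 = j.1
    · obtain ⟨x, y⟩ := i
      obtain ⟨x', y'⟩ := j
      obtain rfl : x = x' := hij
      rw [heq]
    · exact mul_le_mul_of_nonneg_right (hle i j)
        (fderiv_fderiv_smoothMinMax_nonneg l hε z hij)

end gordon

/-! ### From smooth functionals to tail probabilities and exponential moments. -/

section comparison

variable {X Y : Type*} [Fintype X] [Fintype Y] {ι : Type*} [Fintype ι]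

theorem measurableSet_forall_exists (A : ι → X × Y → ℝ) (P : ℝ → Prop) (hP : MeasurableSet {s | P s}) :
    MeasurableSet {w : ι → ℝ | ∀ x, ∃ y, P ((∑ p, w p • A p) (x, y))} := by
  have : {w : ι → ℝ | ∀ x, ∃ y, P ((∑ p, w p • A p) (x, y))} =
      ⋂ x, ⋃ y, (fun w : ι → ℝ => (∑ p, w p • A p) (x, y)) ⁻¹' {s | P s} := by
    ext w; simp
  rw [this]
  refine MeasurableSet.iInter fun x => MeasurableSet.iUnion fun y => ?_
  have hc : Continuous fun w : ι → ℝ => (∑ p, w p • A p) (x, y) := by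
    simp only [Finset.sum_apply, Pi.smul_apply, smul_eq_mul]; fun_prop
  exact hc.measurable hP

variable [DecidableEq X] [DecidableEq Y]

/-- Gordon's comparison inequality. -/
theorem measure_minMax_le (A B : ι → X × Y → ℝ)
    (hAB : ∀ p, A p = 0 ∨ B p = 0)
    (heq : ∀ x y y', ∑ p, B p (x, y) * B p (x, y') = ∑ p, A p (x, y) * A p (x, y'))
    (hle : ∀ i j, ∑ p, B p i * B p j ≤ ∑ p, A p i * A p j) (l : ℝ) :
    stdPi ι {w | ∀ x, ∃ y, l < (∑ p, w p • B p) (x, y)} ≤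
      stdPi ι {w | ∀ x, ∃ y, l < (∑ p, w p • A p) (x, y)} := by
  -- The smooth functional lies between the indicators at levels `l + ε` and `l`, which costs a
  -- margin `ε`.
  have step : ∀ ε > 0, stdPi ι {w | ∀ x, ∃ y, l + ε ≤ (∑ p, w p • B p) (x, y)} ≤
      stdPi ι {w | ∀ x, ∃ y, l < (∑ p, w p • A p) (x, y)} := by
    intro ε hε
    have m1 := measurableSet_forall_exists B (fun s => l + ε ≤ s) measurableSet_Ici
    have m2 := measurableSet_forall_exists A (fun s => l < s) measurableSet_Ioi
    have hi : ∀ D : ι → X × Y → ℝ,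
        Integrable (fun w => smoothMinMax l ε (∑ p, w p • D p)) (stdPi ι) := by
      intro D
      have hc : Continuous fun w : ι → ℝ => ∑ p, w p • D p := by fun_prop
      refine (integrable_const (1 : ℝ)).mono' ((isBddC2_smoothMinMax l hε).contDiff.continuous.comp
        hc).aestronglyMeasurable (ae_of_all _ fun w => ?_)
      have := smoothMinMax_mem l ε (∑ p, w p • D p)
      rw [Real.norm_eq_abs, abs_of_nonneg this.1]
      exact this.2
    have h := integral_smoothMinMax_le l hε A B hAB heq hle
    have h1 : (stdPi ι).real {w | ∀ x, ∃ y, l + ε ≤ (∑ p, w p • B p) (x, y)} ≤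
        ∫ w, smoothMinMax l ε (∑ p, w p • B p) ∂(stdPi ι) := by
      rw [← integral_indicator_one m1]
      refine integral_mono ((integrable_const (1 : ℝ)).indicator m1) (hi B) fun w => ?_
      by_cases hw : w ∈ {w : ι → ℝ | ∀ x, ∃ y, l + ε ≤ (∑ p, w p • B p) (x, y)}
      · simp only [indicator_of_mem hw]
        rw [smoothMinMax_eq_one hε hw]; rfl
      · simp only [indicator_of_notMem hw]
        exact (smoothMinMax_mem _ _ _).1
    have h2 : ∫ w, smoothMinMax l ε (∑ p, w p • A p) ∂(stdPi ι) ≤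
        (stdPi ι).real {w | ∀ x, ∃ y, l < (∑ p, w p • A p) (x, y)} := by
      rw [← integral_indicator_one m2]
      refine integral_mono (hi A) ((integrable_const (1 : ℝ)).indicator m2) fun w => ?_
      by_cases hw : w ∈ {w : ι → ℝ | ∀ x, ∃ y, l < (∑ p, w p • A p) (x, y)}
      · simp only [indicator_of_mem hw]
        exact (smoothMinMax_mem _ _ _).2
      · simp only [indicator_of_notMem hw]
        exact (smoothMinMax_eq_zero hε hw).le
    exact (ENNReal.toReal_le_toReal (measure_ne_top _ _) (measure_ne_top _ _)).1
      (h1.trans (h.trans h2))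
  -- The margin is removed by exhaustion: `X` is finite, so strict inequality at every `x` leaves a
  -- common positive gap.
  have hmono : Monotone fun n : ℕ =>
      {w : ι → ℝ | ∀ x, ∃ y, l + 1 / ((n : ℝ) + 1) ≤ (∑ p, w p • B p) (x, y)} := by
    intro a b hab w hw x
    obtain ⟨y, hy⟩ := hw x
    have hab' : (a : ℝ) ≤ b := by exact_mod_cast hab
    exact ⟨y, le_trans (by gcongr) hy⟩
  have hsub : {w : ι → ℝ | ∀ x, ∃ y, l < (∑ p, w p • B p) (x, y)} ⊆ ⋃ n : ℕ,
      {w : ι → ℝ | ∀ x, ∃ y, l + 1 / ((n : ℝ) + 1) ≤ (∑ p, w p • B p) (x, y)} := by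
    intro w hw
    choose y hy using hw
    have hlim : Tendsto (fun n : ℕ => l + 1 / ((n : ℝ) + 1)) atTop (𝓝 l) := by
      simpa using tendsto_one_div_add_atTop_nhds_zero_nat.const_add l
    obtain ⟨n, hn⟩ := (eventually_all.2 fun x => hlim.eventually (ge_mem_nhds (hy x))).exists
    exact mem_iUnion.2 ⟨n, fun x => ⟨y x, hn x⟩⟩
  refine (measure_mono hsub).trans ?_
  rw [hmono.measure_iUnion]
  exact iSup_le fun n => step _ (by positivity)

/-- Layer-cake formula: the superlevel sets of `exp (-c * F)` are sublevel sets of `F`. -/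
theorem lintegral_exp_neg_le_of_measure_le {Ω : Type*} [MeasurableSpace Ω] {μ : Measure Ω}
    {F G : Ω → ℝ} (hF : Measurable F) (hG : Measurable G)
    (h : ∀ l, μ {w | F w ≤ l} ≤ μ {w | G w ≤ l}) {c : ℝ} (hc : 0 < c) :
    ∫⁻ w, ENNReal.ofReal (Real.exp (-c * F w)) ∂μ ≤
      ∫⁻ w, ENNReal.ofReal (Real.exp (-c * G w)) ∂μ := by
  rw [lintegral_eq_lintegral_meas_le _ (ae_of_all _ fun w => (Real.exp_pos _).le)
      (by fun_prop),
    lintegral_eq_lintegral_meas_le _ (ae_of_all _ fun w => (Real.exp_pos _).le)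
      (by fun_prop)]
  refine setLIntegral_mono' measurableSet_Ioi fun t ht => ?_
  have e : ∀ K : Ω → ℝ, {a | t ≤ Real.exp (-c * K a)} = {a | K a ≤ -Real.log t / c} := by
    intro K
    ext a
    simp only [mem_ofPred_eq]
    rw [← Real.log_le_iff_le_exp ht, le_div_iff₀ hc]
    constructor <;> intro h <;> linarith
  rw [e, e]
  exact h _

end comparison

/-! ### Exponential moments of the absolute value of a normal variable. -/

section oneDim

theorem integrable_exp_mul_abs (t : ℝ) :
    Integrable (fun s : ℝ => Real.exp (t * |s|)) (gaussianReal 0 1) := by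
  have := (integrable_exp_mul_gaussianReal (μ := 0) (v := 1) t).add
    (integrable_exp_mul_gaussianReal (μ := 0) (v := 1) (-t))
  refine this.mono' (by fun_prop) (ae_of_all _ fun s => ?_)
  rw [Real.norm_eq_abs, abs_of_pos (Real.exp_pos _)]
  simp only [Pi.add_apply]
  rcases abs_cases s with ⟨h, _⟩ | ⟨h, _⟩ <;> rw [h]
  · linarith [Real.exp_pos (-t * s)]
  · rw [mul_neg, ← neg_mul]; linarith [Real.exp_pos (t * s)]

/-- Fold the integral onto the positive half-line, complete the square, and rescale by `√2`. -/
theorem integral_exp_neg_mul_abs (t : ℝ) :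
    ∫ s, Real.exp (-t * |s|) ∂(gaussianReal 0 1) = Real.exp (t ^ 2 / 2) * erfc (t / √2) := by
  have h2 : (0 : ℝ) < √2 := by positivity
  have h22 : √(2 : ℝ) ^ 2 = 2 := Real.sq_sqrt (by norm_num)
  have e1 : ∀ s : ℝ, Real.exp (-t * |s|) * gaussianPDFReal 0 1 s =
      (fun r => (√(2 * Real.pi))⁻¹ * Real.exp (t ^ 2 / 2) *
        Real.exp (-((√2)⁻¹ * (r + t)) ^ 2)) |s| := by
    intro s
    simp only [gaussianPDFReal_zero_one]
    rw [mul_left_comm, mul_assoc, ← Real.exp_add, ← Real.exp_add, ← sq_abs s]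
    congr 2
    rw [mul_pow, inv_pow, h22]; ring
  rw [integral_gaussian_eq]
  simp_rw [e1]
  rw [integral_comp_abs (f := fun r => (√(2 * Real.pi))⁻¹ * Real.exp (t ^ 2 / 2) *
    Real.exp (-((√2)⁻¹ * (r + t)) ^ 2)), integral_const_mul]
  have e2 : ∫ r in Ioi (0 : ℝ), Real.exp (-((√2)⁻¹ * (r + t)) ^ 2) =
      ∫ v in Ioi t, Real.exp (-((√2)⁻¹ * v) ^ 2) := by
    have := (measurePreserving_add_right (volume : Measure ℝ) t).setIntegral_preimage_emb
      (measurableEmbedding_addRight t) (fun v => Real.exp (-((√2)⁻¹ * v) ^ 2)) (Ioi t)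
    rw [← this]
    simp
  rw [e2, integral_comp_mul_left_Ioi (fun v => Real.exp (-v ^ 2)) t (inv_pos.2 h2), erfc,
    inv_mul_eq_div, Real.sqrt_mul (by norm_num : (0 : ℝ) ≤ 2)]
  have hp : 0 < √Real.pi := by positivity
  simp only [inv_inv, smul_eq_mul]
  field_simp

end oneDim

/-! ### The scaled cube and the minmax form. -/

section cube

theorem mem_spinCube {n : ℕ} {x : Fin n → ℝ} :
    x ∈ spinCube n ↔ ∀ i, x i = -(1 / √(n : ℝ)) ∨ x i = 1 / √(n : ℝ) := by
  simp [spinCube]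

theorem abs_eq_of_mem_spinCube {n : ℕ} {x : Fin n → ℝ} (hx : x ∈ spinCube n) (i : Fin n) :
    |x i| = 1 / √(n : ℝ) := by
  have h0 : 0 ≤ 1 / √(n : ℝ) := by positivity
  rcases mem_spinCube.1 hx i with h | h <;> rw [h]
  · rw [abs_neg, abs_of_nonneg h0]
  · rw [abs_of_nonneg h0]

theorem sum_mul_self_of_mem_spinCube {n : ℕ} (hn : 0 < n) {x : Fin n → ℝ} (hx : x ∈ spinCube n) :
    ∑ i, x i * x i = 1 := by
  have h : ∀ i, x i * x i = 1 / n := fun i => by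
    rw [← abs_mul_abs_self, abs_eq_of_mem_spinCube hx, div_mul_div_comm, one_mul,
      Real.mul_self_sqrt (Nat.cast_nonneg n)]
  have hn' : (n : ℝ) ≠ 0 := by positivity
  simp [h, hn']

theorem sum_mul_le_one_of_mem_spinCube {n : ℕ} (hn : 0 < n) {x x' : Fin n → ℝ}
    (hx : x ∈ spinCube n) (hx' : x' ∈ spinCube n) : ∑ i, x i * x' i ≤ 1 := by
  have h : 0 ≤ ∑ i, (x i - x' i) ^ 2 := Finset.sum_nonneg fun i _ => sq_nonneg _
  have e : ∑ i, (x i - x' i) ^ 2 =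
      ∑ i, x i * x i + ∑ i, x' i * x' i - 2 * ∑ i, x i * x' i := by
    rw [Finset.mul_sum, ← Finset.sum_add_distrib, ← Finset.sum_sub_distrib]
    exact Finset.sum_congr rfl fun i _ => by ring
  rw [e, sum_mul_self_of_mem_spinCube hn hx, sum_mul_self_of_mem_spinCube hn hx'] at h
  linarith

theorem dotProduct_mulVec_eq {m n : ℕ} (H : Matrix (Fin m) (Fin n) ℝ) (x : Fin n → ℝ)
    (y : Fin m → ℝ) : y ⬝ᵥ (H.mulVec x) = ∑ q : Fin m × Fin n, H q.1 q.2 * (y q.1 * x q.2) := by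
  rw [Fintype.sum_prod_type]
  simp only [dotProduct, Matrix.mulVec, Finset.mul_sum]
  exact Finset.sum_congr rfl fun i _ => Finset.sum_congr rfl fun j _ => by ring

theorem continuous_minmaxForm {m n : ℕ} :
    Continuous fun H : Matrix (Fin m) (Fin n) ℝ => minmaxForm H := by
  unfold minmaxForm
  refine Continuous.finset_inf'_apply _ fun x _ => Continuous.finset_sup'_apply _ fun y _ => ?_
  fun_prop

theorem abs_minmaxForm_le {m n : ℕ} (H : Matrix (Fin m) (Fin n) ℝ) :
    |minmaxForm H| ≤ ∑ q : Fin m × Fin n, |H q.1 q.2| := by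
  have hle : ∀ k : ℕ, 1 / √(k : ℝ) ≤ 1 := fun k => by
    rcases Nat.eq_zero_or_pos k with rfl | hk
    · simp
    · have : (1 : ℝ) ≤ k := by exact_mod_cast hk
      exact (div_le_one (by positivity)).2 (Real.one_le_sqrt.2 this)
  have hb : ∀ x ∈ spinCube n, ∀ y ∈ spinCube m,
      |y ⬝ᵥ (H.mulVec x)| ≤ ∑ q : Fin m × Fin n, |H q.1 q.2| := by
    intro x hx y hy
    rw [dotProduct_mulVec_eq]
    refine (Finset.abs_sum_le_sum_abs _ _).trans (Finset.sum_le_sum fun q _ => ?_)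
    rw [abs_mul, abs_mul, abs_eq_of_mem_spinCube hx, abs_eq_of_mem_spinCube hy]
    exact mul_le_of_le_one_right (abs_nonneg _)
      (mul_le_one₀ (hle m) (by positivity) (hle n))
  obtain ⟨x, hx⟩ := spinCube_nonempty n
  obtain ⟨y, hy⟩ := spinCube_nonempty m
  rw [abs_le]
  constructor
  · refine Finset.le_inf' _ _ fun x hx => ?_
    exact (neg_le_of_abs_le (hb x hx y hy)).trans
      (Finset.le_sup' (fun y => y ⬝ᵥ (H.mulVec x)) hy)
  · refine (Finset.inf'_le _ hx).trans (Finset.sup'_le _ _ fun y hy => ?_)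
    exact le_of_abs_le (hb x hx y hy)

end cube

/-! ### The two Gaussian processes in Gordon's comparison. -/

section process

variable (m n : ℕ)

/-- The index type of the Gaussian variables entering Gordon's comparison: the matrix entries with
one extra variable, and the two vectors of the decoupled process. -/
abbrev GordonIndex : Type := Option (Fin m × Fin n) ⊕ (Fin m ⊕ Fin n)

/-- Coefficients of the bilinear process `yᵀ H x + g`. -/
def bilinearCoeff : GordonIndex m n → (spinCube n × spinCube m) → ℝ
  | .inl (some q), z => z.2.1 q.1 * z.1.1 q.2
  | .inl none, _ => 1
  | .inr _, _ => 0

/-- Coefficients of the decoupled process `gᵀ y + hᵀ x`. -/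
def decoupledCoeff : GordonIndex m n → (spinCube n × spinCube m) → ℝ
  | .inl _, _ => 0
  | .inr (.inl i), z => z.2.1 i
  | .inr (.inr j), z => z.1.1 j

variable {m n}

theorem sum_bilinearCoeff_mul (z z' : spinCube n × spinCube m) :
    ∑ p, bilinearCoeff m n p z * bilinearCoeff m n p z' =
      1 + (∑ i, z.2.1 i * z'.2.1 i) * ∑ j, z.1.1 j * z'.1.1 j := by
  simp only [Fintype.sum_sum_type, Fintype.sum_option, bilinearCoeff, mul_zero,
    Finset.sum_const_zero, add_zero, mul_one, Fintype.sum_prod_type, Finset.sum_mul_sum]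
  congr 1
  exact Finset.sum_congr rfl fun i _ => Finset.sum_congr rfl fun j _ => by ring

theorem sum_decoupledCoeff_mul (z z' : spinCube n × spinCube m) :
    ∑ p, decoupledCoeff m n p z * decoupledCoeff m n p z' =
      ∑ i, z.2.1 i * z'.2.1 i + ∑ j, z.1.1 j * z'.1.1 j := by
  simp [Fintype.sum_sum_type, decoupledCoeff]

theorem sum_smul_bilinearCoeff (w : GordonIndex m n → ℝ) (z : spinCube n × spinCube m) :
    (∑ p, w p • bilinearCoeff m n p) z = w (.inl none) +
      z.2.1 ⬝ᵥ ((Matrix.of fun i j => w (.inl (some (i, j)))).mulVec z.1.1) := by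
  rw [dotProduct_mulVec_eq]
  simp [Fintype.sum_sum_type, Fintype.sum_option, bilinearCoeff]

theorem sum_smul_decoupledCoeff (w : GordonIndex m n → ℝ) (z : spinCube n × spinCube m) :
    (∑ p, w p • decoupledCoeff m n p) z =
      ∑ i, w (.inr (.inl i)) * z.2.1 i + ∑ j, w (.inr (.inr j)) * z.1.1 j := by
  simp [Fintype.sum_sum_type, decoupledCoeff]

theorem lt_of_forall_exists_lt {w : GordonIndex m n → ℝ} {l : ℝ}
    (h : ∀ x, ∃ y, l < (∑ p, w p • bilinearCoeff m n p) (x, y)) :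
    l < minmaxForm (Matrix.of fun i j => w (.inl (some (i, j)))) + w (.inl none) := by
  rw [← sub_lt_iff_lt_add, minmaxForm, Finset.lt_inf'_iff]
  intro x hx
  obtain ⟨y, hy⟩ := h ⟨x, hx⟩
  rw [sum_smul_bilinearCoeff] at hy
  rw [Finset.lt_sup'_iff]
  exact ⟨y.1, y.2, by linarith⟩

theorem exists_mul_eq_of_sign (m : ℕ) (g : Fin m → ℝ) :
    ∃ y ∈ spinCube m, ∀ i, g i * y i = 1 / √(m : ℝ) * |g i| := by
  refine ⟨fun i => if 0 ≤ g i then 1 / √(m : ℝ) else -(1 / √(m : ℝ)),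
    mem_spinCube.2 fun i => ?_, fun i => ?_⟩
  · by_cases h : 0 ≤ g i <;> simp [h]
  · by_cases h : 0 ≤ g i
    · simp [h, abs_of_nonneg h, mul_comm]
    · simp [h, abs_of_neg (not_le.1 h), mul_comm]

/-- The sign pattern of the first vector makes its linear form `1/√m` times the `ℓ¹` norm, while the
form in `x` is at least minus the corresponding quantity for every `x`. Only this lower bound on the
decoupled minmax is needed. -/
theorem forall_exists_lt_of_lt {w : GordonIndex m n → ℝ} {l : ℝ}
    (h : l < 1 / √(m : ℝ) * ∑ i, |w (.inr (.inl i))| - 1 / √(n : ℝ) * ∑ j, |w (.inr (.inr j))|)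
    (x : spinCube n) : ∃ y, l < (∑ p, w p • decoupledCoeff m n p) (x, y) := by
  obtain ⟨y, hy, hyw⟩ := exists_mul_eq_of_sign m fun i => w (.inr (.inl i))
  refine ⟨⟨y, hy⟩, h.trans_le ?_⟩
  rw [sum_smul_decoupledCoeff]
  simp only [hyw, sub_eq_add_neg, Finset.mul_sum, ← Finset.sum_neg_distrib]
  gcongr with j
  refine le_trans ?_ (neg_abs_le _)
  rw [abs_mul, abs_eq_of_mem_spinCube x.2, mul_comm]

/-- Gordon's comparison for the exponential moments of the minmax form. -/
theorem lintegral_exp_minmaxForm_add_le (hm : 0 < m) (hn : 0 < n) {c : ℝ} (hc : 0 < c) :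
    ∫⁻ w, ENNReal.ofReal (Real.exp (-c * (minmaxForm (Matrix.of fun i j => w (.inl (some (i, j)))) +
        w (.inl none)))) ∂(stdPi (GordonIndex m n)) ≤
      ∫⁻ w, ENNReal.ofReal (Real.exp (-c * (1 / √(m : ℝ) * ∑ i, |w (.inr (.inl i))| -
        1 / √(n : ℝ) * ∑ j, |w (.inr (.inr j))|))) ∂(stdPi (GordonIndex m n)) := by
  have cH : Continuous fun w : GordonIndex m n → ℝ =>
      minmaxForm (m := m) (n := n) (Matrix.of fun i j => w (.inl (some (i, j)))) :=
    continuous_minmaxForm.comp (by fun_prop)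
  refine lintegral_exp_neg_le_of_measure_le
    (F := fun w : GordonIndex m n → ℝ => minmaxForm (Matrix.of fun i j => w (.inl (some (i, j)))) +
      w (.inl none))
    (G := fun w : GordonIndex m n → ℝ => 1 / √(m : ℝ) * ∑ i, |w (.inr (.inl i))| -
      1 / √(n : ℝ) * ∑ j, |w (.inr (.inr j))|)
    (cH.add (continuous_apply _)).measurable (by fun_prop) (fun l => ?_) hc
  have key := measure_minMax_le (bilinearCoeff m n) (decoupledCoeff m n) ?_ ?_ ?_ l
  · have mA := measurableSet_forall_exists (bilinearCoeff m n) (fun s => l < s) measurableSet_Ioi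
    have mB := measurableSet_forall_exists (decoupledCoeff m n) (fun s => l < s) measurableSet_Ioi
    have h1 : {w : GordonIndex m n → ℝ | minmaxForm (Matrix.of fun i j => w (.inl (some (i, j)))) +
        w (.inl none) ≤ l} ⊆ {w | ∀ x, ∃ y, l < (∑ p, w p • bilinearCoeff m n p) (x, y)}ᶜ :=
      fun w hw hw' => absurd (lt_of_forall_exists_lt hw') (not_lt.2 hw)
    have h2 : {w : GordonIndex m n → ℝ |
        ∀ x, ∃ y, l < (∑ p, w p • decoupledCoeff m n p) (x, y)}ᶜ ⊆
        {w | 1 / √(m : ℝ) * ∑ i, |w (.inr (.inl i))| -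
          1 / √(n : ℝ) * ∑ j, |w (.inr (.inr j))| ≤ l} :=
      fun w hw => not_lt.1 fun hw' => hw (forall_exists_lt_of_lt hw')
    refine (measure_mono h1).trans (le_trans ?_ (measure_mono h2))
    rw [prob_compl_eq_one_sub mA, prob_compl_eq_one_sub mB]
    exact tsub_le_tsub_left key 1
  · rintro (p | p)
    · exact Or.inr (funext fun z => rfl)
    · exact Or.inl (funext fun z => rfl)
  · intro x y y'
    rw [sum_bilinearCoeff_mul, sum_decoupledCoeff_mul]
    simp [sum_mul_self_of_mem_spinCube hn x.2, add_comm]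
  · intro z z'
    rw [sum_bilinearCoeff_mul, sum_decoupledCoeff_mul]
    -- The covariance difference is `(1 - x·x')(1 - y·y')`, with both inner products at most `1`.
    nlinarith [sum_mul_le_one_of_mem_spinCube hn z.1.2 z'.1.2,
      sum_mul_le_one_of_mem_spinCube hm z.2.2 z'.2.2]

end process

/-! ### The exponential moment bound for the minmax form. -/

section moments

theorem map_comp_stdPi {ι κ : Type*} [Fintype ι] [Fintype κ] {f : κ → ι}
    (hf : Function.Injective f) :
    (stdPi ι).map (fun w q => w (f q)) = stdPi κ := by
  have h1 : iIndepFun (fun (i : ι) (w : ι → ℝ) => w i) (stdPi ι) :=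
    iIndepFun_pi (X := fun _ s => s) fun _ => aemeasurable_id
  have h2 := (h1.precomp hf).map_fun_eq_pi_map fun q => (measurable_pi_apply (f q)).aemeasurable
  rw [h2]
  congr 1
  funext q
  exact (measurePreserving_eval (fun _ : ι => gaussianReal 0 1) (f q)).map_eq

theorem IsStdGaussianMatrix.map_eq {m n : ℕ} {Ω : Type*} [MeasurableSpace Ω] {P : Measure Ω}
    [IsProbabilityMeasure P] {H : Ω → Matrix (Fin m) (Fin n) ℝ} (hH : IsStdGaussianMatrix H P) :
    P.map (fun ω (q : Fin m × Fin n) => H ω q.1 q.2) = stdPi (Fin m × Fin n) := by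
  refine (hH.indep.map_fun_eq_pi_map fun (q : Fin m × Fin n) => (hH.hasLaw q.1 q.2).aemeasurable).trans ?_
  congr 1
  funext q
  exact (hH.hasLaw q.1 q.2).map_eq

theorem IsStdGaussianMatrix.aemeasurable {m n : ℕ} {Ω : Type*} [MeasurableSpace Ω] {P : Measure Ω}
    {H : Ω → Matrix (Fin m) (Fin n) ℝ} (hH : IsStdGaussianMatrix H P) :
    AEMeasurable (fun ω (q : Fin m × Fin n) => H ω q.1 q.2) P :=
  aemeasurable_pi_lambda _ fun q => (hH.hasLaw q.1 q.2).aemeasurable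

theorem continuous_minmaxForm_of {m n : ℕ} :
    Continuous fun v : Fin m × Fin n → ℝ => minmaxForm (Matrix.of fun i j => v (i, j)) :=
  continuous_minmaxForm.comp (by fun_prop)

theorem IsStdGaussianMatrix.aemeasurable_minmaxForm {m n : ℕ} {Ω : Type*} [MeasurableSpace Ω]
    {P : Measure Ω} {H : Ω → Matrix (Fin m) (Fin n) ℝ} (hH : IsStdGaussianMatrix H P) :
    AEMeasurable (fun ω => minmaxForm (H ω)) P :=
  (continuous_minmaxForm_of.measurable.comp_aemeasurable hH.aemeasurable).congr
    (ae_of_all _ fun ω => congrArg minmaxForm (rfl : Matrix.of (fun i j => H ω i j) = H ω))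

/-- The law of the entries determines these integrals, so they can be computed on the canonical
space that also carries the auxiliary variables. -/
theorem IsStdGaussianMatrix.lintegral_comp {m n : ℕ} {Ω : Type*} [MeasurableSpace Ω]
    {P : Measure Ω} [IsProbabilityMeasure P] {H : Ω → Matrix (Fin m) (Fin n) ℝ}
    (hH : IsStdGaussianMatrix H P) {φ : ℝ → ENNReal} (hφ : Measurable φ) :
    ∫⁻ ω, φ (minmaxForm (H ω)) ∂P =
      ∫⁻ w, φ (minmaxForm (Matrix.of fun i j => w (.inl (some (i, j)))))
        ∂(stdPi (GordonIndex m n)) := by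
  have hm : Measurable fun v : Fin m × Fin n → ℝ =>
      φ (minmaxForm (Matrix.of fun i j => v (i, j))) :=
    hφ.comp continuous_minmaxForm_of.measurable
  have hinj : Function.Injective fun q : Fin m × Fin n => (Sum.inl (some q) : GordonIndex m n) :=
    fun a b h => by simpa using h
  have e1 := lintegral_map' hm.aemeasurable hH.aemeasurable
  have e2 := lintegral_map (μ := stdPi (GordonIndex m n)) hm
    (g := fun w (q : Fin m × Fin n) => w (.inl (some q))) (by fun_prop)
  rw [hH.map_eq] at e1
  rw [map_comp_stdPi hinj] at e2
  exact e1.symm.trans e2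

theorem IsStdGaussianMatrix.integrable_minmaxForm {m n : ℕ} {Ω : Type*} [MeasurableSpace Ω]
    {P : Measure Ω} {H : Ω → Matrix (Fin m) (Fin n) ℝ} (hH : IsStdGaussianMatrix H P) :
    Integrable (fun ω => minmaxForm (H ω)) P := by
  have hi : ∀ q : Fin m × Fin n, Integrable (fun ω => H ω q.1 q.2) P := by
    intro q
    have h := hH.hasLaw q.1 q.2
    have := integrable_id_gaussian
    rw [← h.map_eq] at this
    exact (integrable_map_measure this.aestronglyMeasurable h.aemeasurable).1 this
  exact (integrable_finsetSum _ fun q _ => (hi q).abs).mono'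
    hH.aemeasurable_minmaxForm.aestronglyMeasurable (ae_of_all _ fun ω => abs_minmaxForm_le (H ω))

theorem integral_exp_neg_mul_gaussian (c : ℝ) :
    ∫ s, Real.exp (-c * s) ∂(gaussianReal 0 1) = Real.exp (c ^ 2 / 2) := by
  have := congrFun (mgf_id_gaussianReal (μ := 0) (v := 1)) (-c)
  simpa [mgf] using this

variable {m n : ℕ}

/-- The extra variable is independent of the matrix entries, so it integrates out as a factor that
can later be divided away. -/
theorem lintegral_exp_minmaxForm_add (c : ℝ) :
    ∫⁻ w, ENNReal.ofReal (Real.exp (-c * (minmaxForm (Matrix.of fun i j => w (.inl (some (i, j)))) +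
        w (.inl none)))) ∂(stdPi (GordonIndex m n)) =
      (∫⁻ w, ENNReal.ofReal (Real.exp (-c * minmaxForm (Matrix.of fun i j => w (.inl (some (i, j))))))
        ∂(stdPi (GordonIndex m n))) * ENNReal.ofReal (Real.exp (c ^ 2 / 2)) := by
  have cH : Continuous fun w : GordonIndex m n → ℝ =>
      minmaxForm (m := m) (n := n) (Matrix.of fun i j => w (.inl (some (i, j)))) :=
    continuous_minmaxForm.comp (by fun_prop)
  have mp := measurePreserving_update (ι := GordonIndex m n) (.inl none)
  have mF : Measurable fun w : GordonIndex m n → ℝ => ENNReal.ofReal (Real.exp (-c *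
      (minmaxForm (Matrix.of fun i j => w (.inl (some (i, j)))) + w (.inl none)))) := by
    have := cH.measurable
    fun_prop
  rw [← mp.lintegral_comp mF, lintegral_prod _ (by exact (mF.comp mp.measurable).aemeasurable),
    ← lintegral_mul_const _ (by have := cH.measurable; fun_prop)]
  refine lintegral_congr fun w => ?_
  have e : ∀ s : ℝ, ENNReal.ofReal (Real.exp (-c * (minmaxForm (Matrix.of fun i j =>
      Function.update w (.inl none) s (.inl (some (i, j)))) +
        Function.update w (.inl none) s (.inl none)))) =
      ENNReal.ofReal (Real.exp (-c * minmaxForm (Matrix.of fun i j => w (.inl (some (i, j)))))) *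
        ENNReal.ofReal (Real.exp (-c * s)) := by
    intro s
    rw [← ENNReal.ofReal_mul (Real.exp_pos _).le, ← Real.exp_add, ← mul_add]
    simp
  simp only [e]
  rw [lintegral_const_mul _ (by fun_prop), ← integral_exp_neg_mul_gaussian,
    ofReal_integral_eq_lintegral_ofReal (integrable_exp_mul_gaussianReal (-c))
      (ae_of_all _ fun s => (Real.exp_pos _).le)]

theorem lintegral_exp_decoupled (c : ℝ) :
    ∫⁻ w, ENNReal.ofReal (Real.exp (-c * (1 / √(m : ℝ) * ∑ i, |w (.inr (.inl i))| -
        1 / √(n : ℝ) * ∑ j, |w (.inr (.inr j))|))) ∂(stdPi (GordonIndex m n)) =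
      ENNReal.ofReal ((Real.exp ((c / √(m : ℝ)) ^ 2 / 2) * erfc (c / √(m : ℝ) / √2)) ^ m *
        (Real.exp ((-c / √(n : ℝ)) ^ 2 / 2) * erfc (-c / √(n : ℝ) / √2)) ^ n) := by
  let φ : GordonIndex m n → ℝ → ℝ
    | .inl _, _ => 1
    | .inr (.inl _), s => Real.exp (-(c / √(m : ℝ)) * |s|)
    | .inr (.inr _), s => Real.exp (-(-c / √(n : ℝ)) * |s|)
  have hφ : ∀ p, Integrable (φ p) (gaussianReal 0 1) := by
    rintro (p | p | p)
    · exact integrable_const 1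
    · exact integrable_exp_mul_abs _
    · exact integrable_exp_mul_abs _
  have e : ∀ w : GordonIndex m n → ℝ, Real.exp (-c * (1 / √(m : ℝ) * ∑ i, |w (.inr (.inl i))| -
      1 / √(n : ℝ) * ∑ j, |w (.inr (.inr j))|)) = ∏ p, φ p (w p) := by
    intro w
    simp only [Fintype.prod_sum_type, φ, Finset.prod_const_one, one_mul, ← Real.exp_sum,
      ← Real.exp_add, ← Finset.mul_sum]
    congr 1
    ring
  simp only [e]
  rw [← ofReal_integral_eq_lintegral_ofReal (Integrable.fintype_prod hφ)
    (ae_of_all _ fun w => by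
      have := (Real.exp_pos _).le.trans_eq (e w)
      exact this),
    integral_fintype_prod_eq_prod]
  simp only [Fintype.prod_sum_type, φ, integral_exp_neg_mul_abs]
  simp

theorem erfc_pos (x : ℝ) : 0 < erfc x := by
  have h : 0 < ∫ t in Ioi x, Real.exp (-t ^ 2) := by
    have hi : Integrable (fun t : ℝ => Real.exp (-t ^ 2)) := by
      simpa using integrable_exp_neg_mul_sq one_pos
    rw [setIntegral_pos_iff_support_of_nonneg_ae (ae_of_all _ fun t => (Real.exp_pos _).le)
      hi.integrableOn]
    have : Function.support (fun t : ℝ => Real.exp (-t ^ 2)) = univ :=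
      eq_univ_of_forall fun t => (Real.exp_pos _).ne'
    rw [this, univ_inter, Real.volume_Ioi]
    exact ENNReal.zero_lt_top
  unfold erfc
  positivity

/-- The lifted bound on the exponential moments of the minmax form. -/
theorem IsStdGaussianMatrix.lintegral_exp_le {Ω : Type*} [MeasurableSpace Ω] {P : Measure Ω}
    [IsProbabilityMeasure P] {H : Ω → Matrix (Fin m) (Fin n) ℝ} (hH : IsStdGaussianMatrix H P)
    (hm : 0 < m) (hn : 0 < n) {c : ℝ} (hc : 0 < c) :
    ∫⁻ ω, ENNReal.ofReal (Real.exp (-(c * √(n : ℝ)) * minmaxForm (H ω))) ∂P ≤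
      ENNReal.ofReal (Real.exp (-(n * c * liftFun (m / n) c))) := by
  have hm' : (0 : ℝ) < m := by exact_mod_cast hm
  have hn' : (0 : ℝ) < n := by exact_mod_cast hn
  have hsn : 0 < √(n : ℝ) := Real.sqrt_pos.2 hn'
  have hsm : 0 < √(m : ℝ) := Real.sqrt_pos.2 hm'
  -- At this scale the exponents, including those from the `m` and `n` coordinate factors, combine
  -- to a multiple of `n`, with `m` entering otherwise only through `m / n`.
  set d := c * √(n : ℝ)
  have hd : 0 < d := mul_pos hc hsn
  have key := lintegral_exp_minmaxForm_add_le hm hn hd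
  rw [lintegral_exp_minmaxForm_add, lintegral_exp_decoupled,
    ← hH.lintegral_comp (φ := fun s => ENNReal.ofReal (Real.exp (-d * s))) (by fun_prop)] at key
  have hpos : 0 < Real.exp (d ^ 2 / 2) := Real.exp_pos _
  rw [← ENNReal.le_div_iff_mul_le (Or.inl (ENNReal.ofReal_pos.2 hpos).ne')
    (Or.inl ENNReal.ofReal_ne_top), ← ENNReal.ofReal_div_of_pos hpos] at key
  refine key.trans (ENNReal.ofReal_le_ofReal (le_of_eq ?_))
  have a1 : d / √(m : ℝ) / √2 = c / √(2 * (m / n)) := by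
    rw [Real.sqrt_mul (by norm_num), Real.sqrt_div hm'.le]
    simp only [d]; field_simp
  have a2 : -d / √(n : ℝ) / √2 = -c / √2 := by
    simp only [d]; field_simp
  have a3 : (d / √(m : ℝ)) ^ 2 / 2 = c ^ 2 * n / m / 2 := by
    simp only [d]; rw [div_pow, mul_pow, Real.sq_sqrt hm'.le, Real.sq_sqrt hn'.le]
  have a4 : (-d / √(n : ℝ)) ^ 2 / 2 = c ^ 2 / 2 := by
    simp only [d]; rw [div_pow, neg_sq, mul_pow, Real.sq_sqrt hn'.le]; field_simp
  have a5 : d ^ 2 / 2 = n * c ^ 2 / 2 := by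
    simp only [d]; rw [mul_pow, Real.sq_sqrt hn'.le]; ring
  rw [a1, a2, a3, a4, a5, liftFun]
  have b1 : ∀ x, erfc x = Real.exp (Real.log (erfc x)) := fun x =>
    (Real.exp_log (erfc_pos x)).symm
  rw [b1 (c / √(2 * (m / n))), b1 (-c / √2), Real.log_exp, Real.log_exp, ← Real.exp_add,
    ← Real.exp_add, ← Real.exp_nat_mul, ← Real.exp_nat_mul, ← Real.exp_add, ← Real.exp_sub]
  congr 1
  field_simp
  ring

end moments

/-! ### Identities, tail bounds and derivatives for `erfc`. -/

section erfc

theorem integrable_exp_neg_sq : Integrable (fun t : ℝ => Real.exp (-t ^ 2)) := by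
  simpa using integrable_exp_neg_mul_sq one_pos

theorem continuous_exp_neg_sq : Continuous (fun t : ℝ => Real.exp (-t ^ 2)) := by fun_prop

theorem integral_Ioi_zero_exp_neg_sq : ∫ t in Ioi (0 : ℝ), Real.exp (-t ^ 2) = √Real.pi / 2 := by
  simpa using integral_gaussian_Ioi 1

theorem erfc_eq_one_sub (x : ℝ) :
    erfc x = 1 - 2 / √Real.pi * ∫ t in (0 : ℝ)..x, Real.exp (-t ^ 2) := by
  have h := intervalIntegral.integral_interval_add_Ioi (a := 0) (b := x)
    integrable_exp_neg_sq.integrableOn integrable_exp_neg_sq.integrableOn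
  rw [integral_Ioi_zero_exp_neg_sq] at h
  have hp : 0 < √Real.pi := by positivity
  rw [erfc, eq_sub_of_add_eq' h, mul_sub]
  field_simp

theorem erfc_zero : erfc 0 = 1 := by simp [erfc_eq_one_sub]

theorem erfc_neg (x : ℝ) : erfc (-x) = 2 - erfc x := by
  have h := intervalIntegral.integral_comp_neg (a := 0) (b := x) (fun t : ℝ => Real.exp (-t ^ 2))
  simp only [neg_sq, neg_zero] at h
  rw [erfc_eq_one_sub, erfc_eq_one_sub x, h, intervalIntegral.integral_symm (-x) 0]
  ring

theorem hasDerivAt_erfc (x : ℝ) :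
    HasDerivAt erfc (-(2 / √Real.pi * Real.exp (-x ^ 2))) x := by
  have h := (continuous_exp_neg_sq.integral_hasStrictDerivAt 0 x).hasDerivAt
  have := (h.const_mul (2 / √Real.pi)).const_sub 1
  rwa [show erfc = fun x => 1 - 2 / √Real.pi * ∫ t in (0 : ℝ)..x, Real.exp (-t ^ 2) from
    funext erfc_eq_one_sub]

theorem erfc_lt_two (x : ℝ) : erfc x < 2 := by
  linarith [erfc_neg x, erfc_pos (-x)]

theorem antitone_erfc : Antitone erfc :=
  antitone_of_deriv_nonpos (fun x => (hasDerivAt_erfc x).differentiableAt) fun x => by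
    rw [(hasDerivAt_erfc x).deriv, neg_nonpos]; positivity

/-- On `t > x` the weight `t / x` exceeds `1`, and `t * exp (-t ^ 2)` has an explicit primitive. -/
theorem erfc_le {x : ℝ} (hx : 0 < x) : erfc x ≤ Real.exp (-x ^ 2) / (x * √Real.pi) := by
  have hi : IntegrableOn (fun t : ℝ => t * Real.exp (-t ^ 2)) (Ioi x) := by
    have := (integrable_mul_exp_neg_mul_sq one_pos).integrableOn (s := Ioi x)
    simpa using this
  have hd : ∀ t : ℝ, HasDerivAt (fun t : ℝ => -(Real.exp (-t ^ 2) / 2)) (t * Real.exp (-t ^ 2)) t := by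
    intro t
    have := (((hasDerivAt_pow 2 t).fun_neg.exp).div_const 2).fun_neg
    refine this.congr_deriv ?_
    simp only [Nat.cast_ofNat, Nat.add_one_sub_one, pow_one]
    ring
  have hlim : Tendsto (fun t : ℝ => -(Real.exp (-t ^ 2) / 2)) atTop (𝓝 0) := by
    have : Tendsto (fun t : ℝ => -t ^ 2) atTop atBot :=
      tendsto_neg_atTop_atBot.comp (tendsto_pow_atTop two_ne_zero)
    simpa using ((Real.tendsto_exp_atBot.comp this).div_const 2).neg
  have hI := integral_Ioi_of_hasDerivAt_of_tendsto (hd x).continuousAt.continuousWithinAt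
    (fun t _ => hd t) hi hlim
  have hle : x * ∫ t in Ioi x, Real.exp (-t ^ 2) ≤ ∫ t in Ioi x, t * Real.exp (-t ^ 2) := by
    rw [← integral_const_mul]
    refine setIntegral_mono_on (integrable_exp_neg_sq.integrableOn.const_mul x) hi
      measurableSet_Ioi fun t ht => ?_
    exact mul_le_mul_of_nonneg_right (le_of_lt ht) (Real.exp_pos _).le
  rw [hI] at hle
  have hp : 0 < √Real.pi := by positivity
  rw [erfc, le_div_iff₀ (by positivity)]
  have : 2 / √Real.pi * (∫ t in Ioi x, Real.exp (-t ^ 2)) * (x * √Real.pi) =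
      2 * (x * ∫ t in Ioi x, Real.exp (-t ^ 2)) := by field_simp
  rw [this]
  linarith

/-- Keep only `(x, x + 1/x]`: its length is `1/x`, and there `t ^ 2 ≤ x ^ 2 + 2 + 1 / x ^ 2 ≤ x ^ 2
+ 3`. -/
theorem le_erfc {x : ℝ} (hx : 1 ≤ x) : 2 / √Real.pi * (Real.exp (-x ^ 2 - 3) / x) ≤ erfc x := by
  have hx0 : 0 < x := by linarith
  unfold erfc
  gcongr
  have h1 : ∫ t in Ioc x (x + 1 / x), Real.exp (-t ^ 2) ≤ ∫ t in Ioi x, Real.exp (-t ^ 2) :=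
    setIntegral_mono_set integrable_exp_neg_sq.integrableOn
      (ae_of_all _ fun t => (Real.exp_pos _).le) Ioc_subset_Ioi_self.eventuallyLE
  have h2 : ∫ t in Ioc x (x + 1 / x), Real.exp (-x ^ 2 - 3) ≤
      ∫ t in Ioc x (x + 1 / x), Real.exp (-t ^ 2) := by
    refine setIntegral_mono_on (integrable_const _) integrable_exp_neg_sq.integrableOn
      measurableSet_Ioc fun t ht => Real.exp_le_exp.2 ?_
    have h3 : t ^ 2 ≤ (x + 1 / x) ^ 2 := by
      have := ht.1
      exact pow_le_pow_left₀ (by linarith) ht.2 2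
    have h4 : (x + 1 / x) ^ 2 = x ^ 2 + 2 + (1 / x) ^ 2 := by field_simp; ring
    have h5 : (1 / x) ^ 2 ≤ 1 := pow_le_one₀ (by positivity) ((div_le_one hx0).2 hx)
    linarith
  refine le_trans (le_of_eq ?_) (h2.trans h1)
  simp [measureReal_def, Real.volume_Ioc, hx0.le, div_eq_inv_mul]

/-- The negative logarithmic derivative of `erfc`. -/
noncomputable def millsRatioInv (x : ℝ) : ℝ :=
  2 / √Real.pi * Real.exp (-x ^ 2) / erfc x

theorem continuous_erfc : Continuous erfc :=
  continuous_iff_continuousAt.2 fun x => (hasDerivAt_erfc x).continuousAt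

theorem continuous_millsRatioInv : Continuous millsRatioInv := by
  unfold millsRatioInv
  exact (by fun_prop : Continuous fun x : ℝ => 2 / √Real.pi * Real.exp (-x ^ 2)).div
    continuous_erfc fun x => (erfc_pos x).ne'

theorem hasDerivAt_log_erfc (x : ℝ) :
    HasDerivAt (fun x => Real.log (erfc x)) (-millsRatioInv x) x := by
  have := (hasDerivAt_erfc x).log (erfc_pos x).ne'
  rwa [neg_div] at this

theorem hasDerivAt_millsRatioInv (x : ℝ) :
    HasDerivAt millsRatioInv (millsRatioInv x * (millsRatioInv x - 2 * x)) x := by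
  have h1 : HasDerivAt (fun x : ℝ => 2 / √Real.pi * Real.exp (-x ^ 2))
      (2 / √Real.pi * (Real.exp (-x ^ 2) * -(2 * x))) x := by
    have := ((hasDerivAt_pow 2 x).fun_neg.exp).const_mul (2 / √Real.pi)
    simpa using this
  have h2 := h1.div (hasDerivAt_erfc x) (erfc_pos x).ne'
  have h0 := (erfc_pos x).ne'
  refine h2.congr_deriv ?_
  unfold millsRatioInv
  field_simp
  ring

theorem millsRatioInv_zero : millsRatioInv 0 = 2 / √Real.pi := by
  simp [millsRatioInv, erfc_zero]

end erfc

/-! ### Attainment and positivity of the lifted bound. -/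

section liftFun

variable {α : ℝ}

theorem continuousOn_liftFun (α : ℝ) : ContinuousOn (liftFun α) (Ioi 0) := by
  have h1 : Continuous fun c : ℝ => Real.log (erfc (-c / √2)) :=
    (continuous_erfc.comp (by fun_prop)).log fun c => (erfc_pos _).ne'
  have h2 : Continuous fun c : ℝ => Real.log (erfc (c / √(2 * α))) :=
    (continuous_erfc.comp (by fun_prop)).log fun c => (erfc_pos _).ne'
  have h3 : ∀ k : ℝ, ContinuousOn (fun c : ℝ => k / c) (Ioi 0) := fun k =>
    continuousOn_const.div continuousOn_id fun c hc => (ne_of_gt hc)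
  unfold liftFun
  exact ((by fun_prop : Continuous fun c : ℝ => -c / 2).continuousOn.sub
    ((h3 1).mul h1.continuousOn)).sub ((h3 α).mul h2.continuousOn)

/-- The function `c * liftFun α c`. -/
noncomputable def liftPot (α c : ℝ) : ℝ :=
  -c ^ 2 / 2 - Real.log (erfc (-c / √2)) - α * Real.log (erfc (c / √(2 * α)))

theorem liftFun_eq_liftPot_div {c : ℝ} (hc : 0 < c) : liftFun α c = liftPot α c / c := by
  unfold liftFun liftPot
  field_simp

/-- The second derivative at `0` is `4 / π - 1 > 0`, whatever `α` is, and it is continuous. -/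
theorem exists_convexOn_liftPot (hα : 0 < α) : ∃ δ > 0, ConvexOn ℝ (Icc 0 δ) (liftPot α) := by
  have h2 : (0 : ℝ) < √2 := by positivity
  have hs : 0 < √(2 * α) := by positivity
  have h22 : √(2 : ℝ) * √2 = 2 := Real.mul_self_sqrt (by norm_num)
  have hss : √(2 * α) * √(2 * α) = 2 * α := Real.mul_self_sqrt (by positivity)
  set r := millsRatioInv
  set f' : ℝ → ℝ := fun c => -c - r (-c / √2) / √2 + α * r (c / √(2 * α)) / √(2 * α)
  set g : ℝ → ℝ := fun x => r x * (r x - 2 * x)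
  set f'' : ℝ → ℝ := fun c => -1 + g (-c / √2) / 2 + g (c / √(2 * α)) / 2
  have hl1 : ∀ c : ℝ, HasDerivAt (fun c : ℝ => -c / √2) (-1 / √2) c := fun c =>
    (hasDerivAt_id c).fun_neg.div_const _
  have hl2 : ∀ c : ℝ, HasDerivAt (fun c : ℝ => c / √(2 * α)) (1 / √(2 * α)) c := fun c =>
    (hasDerivAt_id c).div_const _
  have hd1 : ∀ c, HasDerivAt (liftPot α) (f' c) c := by
    intro c
    have a0 : HasDerivAt (fun c : ℝ => -c ^ 2 / 2) (-c) c := by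
      have := (hasDerivAt_pow 2 c).fun_neg.div_const 2
      refine this.congr_deriv ?_
      push_cast; ring
    have a1 := (hasDerivAt_log_erfc (-c / √2)).comp c (hl1 c)
    have a2 := (hasDerivAt_log_erfc (c / √(2 * α))).comp c (hl2 c)
    refine ((a0.sub a1).sub (a2.const_mul α)).congr_deriv ?_
    simp only [f', r]; ring
  have hd2 : ∀ c, HasDerivAt f' (f'' c) c := by
    intro c
    have a1 := ((hasDerivAt_millsRatioInv (-c / √2)).comp c (hl1 c)).div_const √2
    have a2 := (((hasDerivAt_millsRatioInv (c / √(2 * α))).comp c (hl2 c)).const_mul α).div_const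
      √(2 * α)
    refine (((hasDerivAt_id c).neg.sub a1).add a2).congr_deriv ?_
    have e1 : g (-c / √2) * (-1 / √2) / √2 = -(g (-c / √2) / 2) := by
      rw [mul_div_assoc, div_div, h22]; ring
    have e2 : α * (g (c / √(2 * α)) * (1 / √(2 * α))) / √(2 * α) = g (c / √(2 * α)) / 2 := by
      rw [mul_div_assoc, mul_div_assoc, div_div, hss]; field_simp
    simp only [f'', ← e2]
    linarith [e1]
  have hgc : Continuous g := by
    have := continuous_millsRatioInv
    simp only [g, r]; fun_prop
  have hc2 : Continuous f'' := by
    simp only [f'']; fun_prop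
  have h0 : 0 < f'' 0 := by
    have hp : √Real.pi * √Real.pi = Real.pi := Real.mul_self_sqrt Real.pi_pos.le
    have : f'' 0 = -1 + 4 / Real.pi := by
      simp only [f'', g, r]
      simp only [neg_zero, zero_div, millsRatioInv_zero, mul_zero, sub_zero]
      rw [div_mul_div_comm, hp]; ring
    rw [this]
    have : 1 < 4 / Real.pi := by rw [lt_div_iff₀ Real.pi_pos]; linarith [Real.pi_lt_four]
    linarith
  obtain ⟨δ, hδ, hball⟩ := Metric.eventually_nhds_iff.1
    (hc2.continuousAt.eventually (lt_mem_nhds h0))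
  refine ⟨δ / 2, by positivity, convexOn_of_hasDerivWithinAt2_nonneg (f' := f') (f'' := f'')
    (convex_Icc _ _) (fun c _ => (hd1 c).continuousAt.continuousWithinAt)
    (fun c _ => (hd1 c).hasDerivWithinAt) (fun c _ => (hd2 c).hasDerivWithinAt) fun c hc => ?_⟩
  rw [interior_Icc] at hc
  refine (hball ?_).le
  rw [Real.dist_eq, sub_zero, abs_of_pos hc.1]
  linarith [hc.2]

/-- A convex function vanishing at `0` lies below its chord from the origin, so its quotient by `c`
is largest at `δ`. Small `c` can thus be ignored when maximizing. -/
theorem exists_liftFun_le_near_zero (hα : 0 < α) :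
    ∃ δ > 0, ∀ c ∈ Ioc 0 δ, liftFun α c ≤ liftFun α δ := by
  obtain ⟨δ, hδ, hconv⟩ := exists_convexOn_liftPot hα
  refine ⟨δ, hδ, fun c hc => ?_⟩
  have ha : 0 ≤ 1 - c / δ := sub_nonneg.2 ((div_le_one hδ).2 hc.2)
  have hb : 0 ≤ c / δ := (div_pos hc.1 hδ).le
  have h := hconv.2 (left_mem_Icc.2 hδ.le) (right_mem_Icc.2 hδ.le) ha hb (sub_add_cancel 1 _)
  have e0 : liftPot α 0 = 0 := by simp [liftPot, erfc_zero]
  simp only [smul_eq_mul, mul_zero, zero_add, e0, div_mul_cancel₀ c hδ.ne'] at h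
  rw [liftFun_eq_liftPot_div hc.1, liftFun_eq_liftPot_div hδ, div_le_iff₀ hc.1]
  exact h.trans (le_of_eq (by ring))

/-- The Gaussian factor of the `erfc` tail cancels `-c ^ 2 / 2` exactly. What is left in `liftPot`
is at least a logarithm growing without bound minus `log 2`. -/
theorem eventually_liftFun_pos (hα : 0 < α) : ∀ᶠ c in atTop, 0 < liftFun α c := by
  have hs : 0 < √(2 * α) := by positivity
  have hp : 0 < √Real.pi := by positivity
  have hlim : Tendsto (fun c : ℝ => α * Real.log (c / √(2 * α) * √Real.pi)) atTop atTop :=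
    (Real.tendsto_log_atTop.comp
      ((tendsto_id.atTop_div_const hs).atTop_mul_const hp)).const_mul_atTop hα
  filter_upwards [hlim.eventually_gt_atTop (Real.log 2), eventually_gt_atTop 0] with c hc hc0
  rw [liftFun_eq_liftPot_div hc0]
  refine div_pos ?_ hc0
  have h1 : Real.log (erfc (-c / √2)) ≤ Real.log 2 :=
    Real.log_le_log (erfc_pos _) (erfc_lt_two _).le
  have hz : 0 < c / √(2 * α) := by positivity
  have h2 : Real.log (erfc (c / √(2 * α))) ≤ -(c ^ 2 / (2 * α)) -
      Real.log (c / √(2 * α) * √Real.pi) := by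
    refine (Real.log_le_log (erfc_pos _) (erfc_le hz)).trans (le_of_eq ?_)
    rw [Real.log_div (Real.exp_pos _).ne' (by positivity), Real.log_exp, div_pow,
      Real.sq_sqrt (by positivity)]
  have h3 := mul_le_mul_of_nonneg_left h2 hα.le
  have h4 : α * (-(c ^ 2 / (2 * α)) - Real.log (c / √(2 * α) * √Real.pi)) =
      -(c ^ 2 / 2) - α * Real.log (c / √(2 * α) * √Real.pi) := by field_simp
  unfold liftPot
  linarith

/-- After the same cancellation, the lower tail bound leaves terms of order `log c / c` and `1 / c`;
the other logarithm has a favourable sign and is dropped. -/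
theorem eventually_liftFun_lt (hα : 0 < α) {ε : ℝ} (hε : 0 < ε) :
    ∀ᶠ c in atTop, liftFun α c < ε := by
  have hs : 0 < √(2 * α) := by positivity
  have hlim : Tendsto (fun c : ℝ => α * (Real.log c / c) +
      α * (3 - Real.log √(2 * α)) * c⁻¹) atTop (𝓝 0) := by
    have h1 : Tendsto (fun c : ℝ => Real.log c / c) atTop (𝓝 0) :=
      Real.isLittleO_log_id_atTop.tendsto_div_nhds_zero
    simpa using (h1.const_mul α).add (tendsto_inv_atTop_zero.const_mul (α * (3 - Real.log √(2 * α))))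
  filter_upwards [hlim.eventually (gt_mem_nhds hε), eventually_gt_atTop 0,
    eventually_ge_atTop √(2 * α)] with c hc hc0 hcs
  refine lt_of_le_of_lt ?_ hc
  have hz : 1 ≤ c / √(2 * α) := (one_le_div hs).2 hcs
  have hz0 : 0 < c / √(2 * α) := by positivity
  have h1 : 0 ≤ Real.log (erfc (-c / √2)) := by
    refine Real.log_nonneg ?_
    rw [← erfc_zero]
    exact antitone_erfc (div_nonpos_of_nonpos_of_nonneg (by linarith) (by positivity))
  have h2 : -(c ^ 2 / (2 * α)) - 3 - (Real.log c - Real.log √(2 * α)) ≤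
      Real.log (erfc (c / √(2 * α))) := by
    have hp : 1 ≤ 2 / √Real.pi := by
      rw [one_le_div (by positivity), Real.sqrt_le_left (by norm_num)]
      linarith [Real.pi_lt_four]
    refine le_trans (le_of_eq ?_) (Real.log_le_log (by positivity)
      ((le_mul_of_one_le_left (by positivity) hp).trans (le_erfc hz)))
    rw [Real.log_div (Real.exp_pos _).ne' hz0.ne', Real.log_exp, div_pow,
      Real.sq_sqrt (by positivity), Real.log_div hc0.ne' hs.ne']
  have h3 := mul_le_mul_of_nonneg_left h2 hα.le
  have h4 : α * (-(c ^ 2 / (2 * α)) - 3 - (Real.log c - Real.log √(2 * α))) =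
      -(c ^ 2 / 2) - α * 3 - α * Real.log c + α * Real.log √(2 * α) := by field_simp; ring
  rw [liftFun_eq_liftPot_div hc0, div_le_iff₀ hc0]
  have h5 : (α * (Real.log c / c) + α * (3 - Real.log √(2 * α)) * c⁻¹) * c =
      α * Real.log c + α * (3 - Real.log √(2 * α)) := by field_simp
  rw [h5]
  unfold liftPot
  linarith

/-- Points near `0` are dominated by `δ`, points beyond `K` by the positive value at `c₁`, and the
rest lie in a compact interval containing both `δ` and `c₁`. -/
theorem exists_isMaxOn_liftFun (hα : 0 < α) :
    ∃ c > 0, 0 < liftFun α c ∧ ∀ c' > 0, liftFun α c' ≤ liftFun α c := by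
  obtain ⟨c₁, hc₁, hc₁0⟩ := ((eventually_liftFun_pos hα).and (eventually_gt_atTop 0)).exists
  obtain ⟨K, hK⟩ := eventually_atTop.1 (eventually_liftFun_lt hα hc₁)
  obtain ⟨δ, hδ, hnear⟩ := exists_liftFun_le_near_zero hα
  set a := min δ c₁
  set b := max (max K c₁) δ
  have ha : 0 < a := lt_min hδ hc₁0
  have hsub : Icc a b ⊆ Ioi 0 := fun x hx => ha.trans_le hx.1
  have m1 : c₁ ∈ Icc a b := ⟨min_le_right _ _, (le_max_right _ _).trans (le_max_left _ _)⟩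
  have mδ : δ ∈ Icc a b := ⟨min_le_left _ _, le_max_right _ _⟩
  obtain ⟨c, hc, hmax⟩ := isCompact_Icc.exists_isMaxOn ⟨c₁, m1⟩ ((continuousOn_liftFun α).mono hsub)
  refine ⟨c, hsub hc, hc₁.trans_le (hmax m1), fun c' hc' => ?_⟩
  rcases le_or_gt c' δ with h | h
  · exact (hnear c' ⟨hc', h⟩).trans (hmax mδ)
  · rcases le_or_gt K c' with h' | h'
    · exact (hK c' h').le.trans (hmax m1)
    · exact hmax ⟨(min_le_left _ _).trans h.le,
        h'.le.trans ((le_max_left _ _).trans (le_max_left _ _))⟩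

theorem isGreatest_liftedBound (hα : 0 < α) :
    IsGreatest (liftFun α '' Ioi 0) (liftedBound α) := by
  obtain ⟨c, hc, -, hmax⟩ := exists_isMaxOn_liftFun hα
  have h : IsGreatest (liftFun α '' Ioi 0) (liftFun α c) :=
    ⟨mem_image_of_mem _ hc, by rintro _ ⟨c', hc', rfl⟩; exact hmax c' hc'⟩
  rwa [liftedBound, h.csSup_eq]

theorem liftedBound_pos (hα : 0 < α) : 0 < liftedBound α := by
  obtain ⟨c, hc, hpos, -⟩ := exists_isMaxOn_liftFun hα
  exact hpos.trans_le ((isGreatest_liftedBound hα).2 (mem_image_of_mem _ hc))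

end liftFun

/-! ### Alternating Taylor bounds and the reduction for `α = 1`. -/

section taylor

theorem le_of_hasDerivAt_nonneg {f f' : ℝ → ℝ} (hf : ∀ x, HasDerivAt f (f' x) x) {a b : ℝ}
    (hab : a ≤ b) (h : ∀ x ∈ Icc a b, 0 ≤ f' x) : f a ≤ f b :=
  monotoneOn_of_hasDerivWithinAt_nonneg (convex_Icc a b)
    (fun x _ => (hf x).continuousAt.continuousWithinAt) (fun x _ => (hf x).hasDerivWithinAt)
    (fun x hx => h x (interior_subset hx)) (left_mem_Icc.2 hab) (right_mem_Icc.2 hab) hab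

theorem le_of_hasDerivAt_nonpos {f f' : ℝ → ℝ} (hf : ∀ x, HasDerivAt f (f' x) x) {a b : ℝ}
    (hab : a ≤ b) (h : ∀ x ∈ Icc a b, f' x ≤ 0) : f b ≤ f a := by
  have := le_of_hasDerivAt_nonneg (f := fun x => -f x) (f' := fun x => -f' x)
    (fun x => (hf x).fun_neg) hab fun x hx => neg_nonneg.2 (h x hx)
  linarith

/-- The Taylor polynomial of `exp (-u)` with `N` terms. -/
noncomputable def expTaylor (N : ℕ) (u : ℝ) : ℝ :=
  ∑ k ∈ Finset.range N, (-u) ^ k / k.factorial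

theorem hasDerivAt_expTaylor_succ (N : ℕ) (u : ℝ) :
    HasDerivAt (expTaylor (N + 1)) (-expTaylor N u) u := by
  induction N with
  | zero =>
    have : expTaylor 1 = fun _ => (1 : ℝ) := by ext u; simp [expTaylor]
    simpa [this, expTaylor] using hasDerivAt_const u (1 : ℝ)
  | succ N ih =>
    have e : expTaylor (N + 1 + 1) =
        fun u => expTaylor (N + 1) u + (-u) ^ (N + 1) / (N + 1).factorial := by
      ext u; simp [expTaylor, Finset.sum_range_succ]
    have h1 : HasDerivAt (fun u : ℝ => (-u) ^ (N + 1) / (N + 1).factorial)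
        (-((-u) ^ N / N.factorial)) u := by
      have := ((hasDerivAt_id u).fun_neg.fun_pow (N + 1)).div_const ((N + 1).factorial : ℝ)
      refine this.congr_deriv ?_
      rw [Nat.factorial_succ]
      push_cast
      have : (N.factorial : ℝ) ≠ 0 := by positivity
      simp only [id]
      field_simp
    rw [e]
    refine (ih.fun_add h1).congr_deriv ?_
    simp [expTaylor, Finset.sum_range_succ]
    ring

/-- Induction: the signed remainder with `N + 1` terms vanishes at `0`, and its derivative is the
signed remainder with `N` terms. -/
theorem expTaylor_alternating (N : ℕ) {u : ℝ} (hu : 0 ≤ u) :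
    0 ≤ (-1) ^ N * (Real.exp (-u) - expTaylor N u) := by
  induction N generalizing u with
  | zero => simp [expTaylor, (Real.exp_pos (-u)).le]
  | succ N ih =>
    have hd : ∀ x : ℝ, HasDerivAt (fun x => (-1) ^ (N + 1) * (Real.exp (-x) - expTaylor (N + 1) x))
        ((-1) ^ N * (Real.exp (-x) - expTaylor N x)) x := by
      intro x
      refine (((hasDerivAt_id x).fun_neg.exp.fun_sub
        (hasDerivAt_expTaylor_succ N x)).const_mul _).congr_deriv ?_
      simp only [id]
      ring
    have h0 : expTaylor (N + 1) 0 = 1 := by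
      rw [expTaylor, Finset.sum_range_succ']
      simp
    have := le_of_hasDerivAt_nonneg hd hu fun x hx => ih hx.1
    simpa [h0] using this

theorem expTaylor_le {N : ℕ} (hN : Even N) {u : ℝ} (hu : 0 ≤ u) : expTaylor N u ≤ Real.exp (-u) := by
  have := expTaylor_alternating N hu
  rw [hN.neg_one_pow] at this
  linarith

theorem le_expTaylor {N : ℕ} (hN : Odd N) {u : ℝ} (hu : 0 ≤ u) : Real.exp (-u) ≤ expTaylor N u := by
  have := expTaylor_alternating N hu
  rw [hN.neg_one_pow] at this
  linarith

/-- The unnormalized Gaussian integral over `[0, c]`. -/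
noncomputable def gaussInt (c : ℝ) : ℝ :=
  ∫ t in (0 : ℝ)..c, Real.exp (-(t ^ 2 / 2))

theorem hasDerivAt_gaussInt (c : ℝ) : HasDerivAt gaussInt (Real.exp (-(c ^ 2 / 2))) c :=
  ((by fun_prop : Continuous fun t : ℝ => Real.exp (-(t ^ 2 / 2))).integral_hasStrictDerivAt
    0 c).hasDerivAt

theorem gaussInt_zero : gaussInt 0 = 0 := by simp [gaussInt]

/-- The Taylor polynomial of `gaussInt` with `N` terms. -/
noncomputable def gaussTaylor (N : ℕ) (c : ℝ) : ℝ :=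
  ∑ k ∈ Finset.range N, (-1 / 2) ^ k * c ^ (2 * k + 1) / (k.factorial * (2 * k + 1))

theorem hasDerivAt_gaussTaylor (N : ℕ) (c : ℝ) :
    HasDerivAt (gaussTaylor N) (expTaylor N (c ^ 2 / 2)) c := by
  unfold gaussTaylor expTaylor
  refine HasDerivAt.fun_sum fun k _ => ?_
  have := ((hasDerivAt_pow (2 * k + 1) c).const_mul ((-1 / 2 : ℝ) ^ k)).div_const
    (k.factorial * (2 * k + 1) : ℝ)
  refine this.congr_deriv ?_
  have h1 : (k.factorial : ℝ) ≠ 0 := by positivity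
  have h2 : (2 * k + 1 : ℝ) ≠ 0 := by positivity
  rw [show -(c ^ 2 / 2) = (-1 / 2) * c ^ 2 by ring, mul_pow, ← pow_mul]
  push_cast
  field_simp

theorem gaussTaylor_alternating (N : ℕ) {c : ℝ} (hc : 0 ≤ c) :
    0 ≤ (-1) ^ N * (gaussInt c - gaussTaylor N c) := by
  have h := le_of_hasDerivAt_nonneg (f := fun c => (-1) ^ N * (gaussInt c - gaussTaylor N c))
    (f' := fun c => (-1) ^ N * (Real.exp (-(c ^ 2 / 2)) - expTaylor N (c ^ 2 / 2)))
    (fun x => ((hasDerivAt_gaussInt x).fun_sub (hasDerivAt_gaussTaylor N x)).const_mul _) hc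
    fun x _ => expTaylor_alternating N (by positivity)
  have h0 : gaussTaylor N 0 = 0 := by simp [gaussTaylor]
  simpa [h0, gaussInt_zero] using h

theorem gaussTaylor_le {N : ℕ} (hN : Even N) {c : ℝ} (hc : 0 ≤ c) : gaussTaylor N c ≤ gaussInt c := by
  have := gaussTaylor_alternating N hc
  rw [hN.neg_one_pow] at this
  linarith

theorem le_gaussTaylor {N : ℕ} (hN : Odd N) {c : ℝ} (hc : 0 ≤ c) : gaussInt c ≤ gaussTaylor N c := by
  have := gaussTaylor_alternating N hc
  rw [hN.neg_one_pow] at this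
  linarith

theorem erfc_div_sqrt_two (c : ℝ) : erfc (c / √2) = 1 - √(2 / Real.pi) * gaussInt c := by
  have h2 : (0 : ℝ) < √2 := by positivity
  have hp : 0 < √Real.pi := by positivity
  have h22 : √(2 : ℝ) ^ 2 = 2 := Real.sq_sqrt (by norm_num)
  have h := intervalIntegral.inv_mul_integral_comp_div (a := 0) (b := c)
    (f := fun t => Real.exp (-t ^ 2)) √2
  rw [erfc_eq_one_sub, ← zero_div √2, ← h, gaussInt, Real.sqrt_div (by norm_num)]
  simp only [div_pow, h22]
  have : 2 / √Real.pi * (√2)⁻¹ = √2 / √Real.pi := by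
    field_simp
    rw [h22]
  rw [← mul_assoc, this]

theorem gaussInt_lt (c : ℝ) : gaussInt c < √(Real.pi / 2) := by
  have h := erfc_pos (c / √2)
  rw [erfc_div_sqrt_two] at h
  have h1 : √(2 / Real.pi) * √(Real.pi / 2) = 1 := by
    rw [← Real.sqrt_mul (by positivity)]
    have := Real.pi_ne_zero
    rw [show 2 / Real.pi * (Real.pi / 2) = 1 by field_simp, Real.sqrt_one]
  have h3 : 0 < √(2 / Real.pi) := by have := Real.pi_pos; positivity
  by_contra! h2
  nlinarith [mul_le_mul_of_nonneg_left h2 h3.le]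

/-- The factors are `1 + s` and `1 - s`. For `α = 1` this merges both logarithms of `liftFun` into
one. -/
theorem erfc_mul_erfc_neg (c : ℝ) :
    erfc (-c / √2) * erfc (c / √2) = 1 - 2 / Real.pi * gaussInt c ^ 2 := by
  rw [neg_div, erfc_neg, erfc_div_sqrt_two]
  have : √(2 / Real.pi) ^ 2 = 2 / Real.pi := Real.sq_sqrt (by have := Real.pi_pos; positivity)
  linear_combination -gaussInt c ^ 2 * this

theorem one_sub_gaussInt_sq_pos (c : ℝ) : 0 < 1 - 2 / Real.pi * gaussInt c ^ 2 := by
  rw [← erfc_mul_erfc_neg]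
  exact mul_pos (erfc_pos _) (erfc_pos _)

theorem liftFun_one {c : ℝ} (hc : 0 < c) :
    liftFun 1 c = (-(c ^ 2 / 2) - Real.log (1 - 2 / Real.pi * gaussInt c ^ 2)) / c := by
  rw [← erfc_mul_erfc_neg, Real.log_mul (erfc_pos _).ne' (erfc_pos _).ne', liftFun, mul_one]
  field_simp
  ring

theorem liftFun_one_le_iff {c M : ℝ} (hc : 0 < c) :
    liftFun 1 c ≤ M ↔
      0 ≤ 1 - Real.exp (-(M * c + c ^ 2 / 2)) - 2 / Real.pi * gaussInt c ^ 2 := by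
  rw [liftFun_one hc, div_le_iff₀ hc,
    show (0 ≤ 1 - Real.exp (-(M * c + c ^ 2 / 2)) - 2 / Real.pi * gaussInt c ^ 2) ↔
      Real.exp (-(M * c + c ^ 2 / 2)) ≤ 1 - 2 / Real.pi * gaussInt c ^ 2 by
        constructor <;> intro h <;> linarith,
    ← Real.le_log_iff_exp_le (one_sub_gaussInt_sq_pos c)]
  constructor <;> intro h <;> linarith

end taylor

/-! ### Sign analysis of `liftGap` on the half-line. -/

section gap

/-- `liftGap M c ≥ 0` means `liftFun 1 c ≤ M`. -/
noncomputable def liftGap (M c : ℝ) : ℝ :=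
  1 - Real.exp (-(M * c + c ^ 2 / 2)) - 2 / Real.pi * gaussInt c ^ 2

/-- The derivative of `liftGap M` without its Gaussian factor. -/
noncomputable def gapSlope (M c : ℝ) : ℝ :=
  (M + c) * Real.exp (-(M * c)) - 4 / Real.pi * gaussInt c

/-- The derivative of `gapSlope M` without its exponential factor. -/
noncomputable def gapCurv (M c : ℝ) : ℝ :=
  1 - M ^ 2 - M * c - 4 / Real.pi * Real.exp (M * c - c ^ 2 / 2)

variable {M : ℝ}

theorem hasDerivAt_liftGap (c : ℝ) :
    HasDerivAt (liftGap M) (Real.exp (-(c ^ 2 / 2)) * gapSlope M c) c := by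
  have h1 : HasDerivAt (fun c : ℝ => -(M * c + c ^ 2 / 2)) (-(M + c)) c := by
    have := (((hasDerivAt_id c).const_mul M).fun_add ((hasDerivAt_pow 2 c).div_const 2)).fun_neg
    refine this.congr_deriv ?_
    simp
  refine ((h1.exp.const_sub 1).fun_sub
    (((hasDerivAt_gaussInt c).fun_pow 2).const_mul (2 / Real.pi))).congr_deriv ?_
  rw [show -(M * c + c ^ 2 / 2) = -(M * c) + -(c ^ 2 / 2) by ring, Real.exp_add, gapSlope]
  simp
  ring

theorem hasDerivAt_gapSlope (c : ℝ) :
    HasDerivAt (gapSlope M) (Real.exp (-(M * c)) * gapCurv M c) c := by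
  have h1 : HasDerivAt (fun c : ℝ => -(M * c)) (-M) c := by
    have := ((hasDerivAt_id c).const_mul M).fun_neg
    simpa using this
  refine ((((hasDerivAt_id c).const_add M).fun_mul h1.exp).fun_sub
    ((hasDerivAt_gaussInt c).const_mul (4 / Real.pi))).congr_deriv ?_
  have e : Real.exp (-(c ^ 2 / 2)) = Real.exp (-(M * c)) * Real.exp (M * c - c ^ 2 / 2) := by
    rw [← Real.exp_add]; congr 1; ring
  rw [e, gapCurv]
  simp
  ring

/-- The exponent is quadratic with leading term `-c ^ 2 / 2`, so beyond its inflection at `M + 1`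
the exponential is convex. -/
theorem concaveOn_gapCurv : ConcaveOn ℝ (Ici (1 + M)) (gapCurv M) := by
  have hq : ∀ c : ℝ, HasDerivAt (fun c : ℝ => M * c - c ^ 2 / 2) (M - c) c := by
    intro c
    have := ((hasDerivAt_id c).const_mul M).fun_sub ((hasDerivAt_pow 2 c).div_const 2)
    refine this.congr_deriv ?_
    simp
  have h1 : ∀ c, HasDerivAt (gapCurv M)
      (-M - 4 / Real.pi * (Real.exp (M * c - c ^ 2 / 2) * (M - c))) c := by
    intro c
    have := (((hasDerivAt_id c).const_mul M).const_sub (1 - M ^ 2)).fun_sub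
      ((hq c).exp.const_mul (4 / Real.pi))
    refine this.congr_deriv ?_
    simp
  have h2 : ∀ c, HasDerivAt (fun c => -M - 4 / Real.pi * (Real.exp (M * c - c ^ 2 / 2) * (M - c)))
      (-(4 / Real.pi * (Real.exp (M * c - c ^ 2 / 2) * ((M - c) ^ 2 - 1)))) c := by
    intro c
    have := (((hq c).exp.fun_mul ((hasDerivAt_id c).const_sub M)).const_mul
      (4 / Real.pi)).const_sub (-M)
    refine this.congr_deriv ?_
    simp
    ring
  refine concaveOn_of_hasDerivWithinAt2_nonpos (convex_Ici _)
    (fun c _ => (h1 c).continuousAt.continuousWithinAt) (fun c _ => (h1 c).hasDerivWithinAt)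
    (fun c _ => (h2 c).hasDerivWithinAt) fun c hc => ?_
  rw [interior_Ici, mem_Ioi] at hc
  have : 0 ≤ (M - c) ^ 2 - 1 := by nlinarith
  have hp := Real.pi_pos
  rw [neg_nonpos]
  positivity

variable {c₀ : ℝ}

/-- By concavity, `gapCurv` is nonnegative between any two points where it is nonnegative. Being
positive at `c₀`, to its left it can change sign only once, from negative to positive. -/
theorem gapCurv_dichotomy_left (hcurv : ∀ c ∈ Icc 0 (1 + M), gapCurv M c ≤ 0)
    (hc₀ : 1 + M ≤ c₀) (hpos : 0 < gapCurv M c₀) {c : ℝ} (hc : c ≤ c₀) :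
    (∀ x ∈ Icc c c₀, 0 ≤ gapCurv M x) ∨ ∀ x ∈ Icc 0 c, gapCurv M x ≤ 0 := by
  rcases le_or_gt c (1 + M) with h | h
  · exact Or.inr fun x hx => hcurv x ⟨hx.1, hx.2.trans h⟩
  rcases le_or_gt 0 (gapCurv M c) with hj | hj
  · exact Or.inl fun x hx => (le_min hj hpos.le).trans
      (concaveOn_gapCurv.min_le_of_mem_Icc h.le hc₀ hx)
  · refine Or.inr fun x hx => ?_
    rcases le_or_gt x (1 + M) with h' | h'
    · exact hcurv x ⟨hx.1, h'⟩
    · by_contra! hx'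
      exact absurd ((le_min hx'.le hpos.le).trans
        (concaveOn_gapCurv.min_le_of_mem_Icc h'.le hc₀ ⟨hx.2, hc⟩)) (not_le.2 hj)

theorem gapCurv_dichotomy_right (hc₀ : 1 + M ≤ c₀) (hpos : 0 < gapCurv M c₀) {c : ℝ} (hc : c₀ ≤ c) :
    (∀ x ∈ Icc c₀ c, 0 ≤ gapCurv M x) ∨ ∀ x, c ≤ x → gapCurv M x ≤ 0 := by
  rcases le_or_gt 0 (gapCurv M c) with hj | hj
  · exact Or.inl fun x hx => (le_min hpos.le hj).trans
      (concaveOn_gapCurv.min_le_of_mem_Icc hc₀ (hc₀.trans hc) hx)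
  · refine Or.inr fun x hx => ?_
    by_contra! hx'
    exact absurd ((le_min hpos.le hx'.le).trans
      (concaveOn_gapCurv.min_le_of_mem_Icc hc₀ (hc₀.trans (hc.trans hx)) ⟨hc, hx⟩)) (not_le.2 hj)

theorem gapSlope_le_of_nonneg {a b : ℝ} (hab : a ≤ b) (h : ∀ x ∈ Icc a b, 0 ≤ gapCurv M x) :
    gapSlope M a ≤ gapSlope M b :=
  le_of_hasDerivAt_nonneg hasDerivAt_gapSlope hab fun x hx =>
    mul_nonneg (Real.exp_pos _).le (h x hx)

theorem gapSlope_le_of_nonpos {a b : ℝ} (hab : a ≤ b) (h : ∀ x ∈ Icc a b, gapCurv M x ≤ 0) :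
    gapSlope M b ≤ gapSlope M a :=
  le_of_hasDerivAt_nonpos hasDerivAt_gapSlope hab fun x hx =>
    mul_nonpos_of_nonneg_of_nonpos (Real.exp_pos _).le (h x hx)

theorem liftGap_le_of_nonneg {a b : ℝ} (hab : a ≤ b) (h : ∀ x ∈ Icc a b, 0 ≤ gapSlope M x) :
    liftGap M a ≤ liftGap M b :=
  le_of_hasDerivAt_nonneg hasDerivAt_liftGap hab fun x hx =>
    mul_nonneg (Real.exp_pos _).le (h x hx)

theorem liftGap_le_of_nonpos {a b : ℝ} (hab : a ≤ b) (h : ∀ x ∈ Icc a b, gapSlope M x ≤ 0) :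
    liftGap M b ≤ liftGap M a :=
  le_of_hasDerivAt_nonpos hasDerivAt_liftGap hab fun x hx =>
    mul_nonpos_of_nonneg_of_nonpos (Real.exp_pos _).le (h x hx)

/-- This keeps the limit of `liftGap M` at infinity from being negative when `M > 0`, so a
nonincreasing tail must be nonnegative. -/
theorem neg_exp_le_liftGap (c : ℝ) : -Real.exp (-(M * c)) ≤ liftGap M c := by
  have h1 := one_sub_gaussInt_sq_pos c
  have h2 : Real.exp (-(M * c + c ^ 2 / 2)) ≤ Real.exp (-(M * c)) :=
    Real.exp_le_exp.2 (by linarith [sq_nonneg c])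
  unfold liftGap
  linarith

/-- Nonnegativity of `liftGap M` on the half-line follows from its value near its local minimum. -/
theorem liftGap_nonneg (hcurv : ∀ c ∈ Icc 0 (1 + M), gapCurv M c ≤ 0)
    (hc₀ : 1 + M ≤ c₀) (hpos : 0 < gapCurv M c₀) (hM : 0 < M) {ε : ℝ} (hε : 0 ≤ ε)
    (hs : gapSlope M c₀ ≤ 0)
    (hs' : -ε ≤ gapSlope M c₀) (hg : ε * (√(Real.pi / 2) - gaussInt c₀) ≤ liftGap M c₀) {c : ℝ}
    (hc : 0 ≤ c) : 0 ≤ liftGap M c := by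
  have hg0 : 0 ≤ liftGap M c₀ :=
    (mul_nonneg hε (sub_nonneg.2 (gaussInt_lt c₀).le)).trans hg
  rcases le_total c c₀ with hcc | hcc
  · have hL : (∀ x ∈ Icc c c₀, gapSlope M x ≤ 0) → 0 ≤ liftGap M c := fun h =>
      hg0.trans (liftGap_le_of_nonpos hcc h)
    rcases gapCurv_dichotomy_left hcurv hc₀ hpos hcc with h | h
    · exact hL fun x hx =>
        (gapSlope_le_of_nonneg hx.2 fun y hy => h y ⟨hx.1.trans hy.1, hy.2⟩).trans hs
    -- A nonnegative slope at `c` propagates back to `0`, where the gap vanishes; a nonpositive one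
    -- persists up to `c₀`, where the gap is nonnegative.
    · rcases le_total 0 (gapSlope M c) with hk | hk
      · have h0 : liftGap M 0 = 0 := by simp [liftGap, gaussInt_zero]
        rw [← h0]
        exact liftGap_le_of_nonneg hc fun x hx =>
          hk.trans (gapSlope_le_of_nonpos hx.2 fun y hy => h y ⟨hx.1.trans hy.1, hy.2⟩)
      · refine hL fun x hx => ?_
        rcases gapCurv_dichotomy_left hcurv hc₀ hpos hx.2 with h' | h'
        · exact (gapSlope_le_of_nonneg hx.2 h').trans hs
        · exact (gapSlope_le_of_nonpos hx.1 fun y hy => h' y ⟨hc.trans hy.1, hy.2⟩).trans hk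
  · have hR : (∀ x ∈ Icc c₀ c, -ε ≤ gapSlope M x) → 0 ≤ liftGap M c := by
      intro h
      -- Since `c₀` is only an approximate critical point, the slope may dip to `-ε`. Adding `ε *
      -- gaussInt` restores monotonicity, at a total cost of at most `ε * (√(π / 2) - gaussInt c₀)`.
      have := le_of_hasDerivAt_nonneg (f := fun x => liftGap M x + ε * gaussInt x)
        (fun x => (hasDerivAt_liftGap x).fun_add ((hasDerivAt_gaussInt x).const_mul ε)) hcc
        fun x hx => by
          nlinarith [mul_nonneg (Real.exp_pos (-(x ^ 2 / 2))).le (neg_le_iff_add_nonneg.1 (h x hx))]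
      nlinarith [mul_le_mul_of_nonneg_left (gaussInt_lt c).le hε]
    rcases gapCurv_dichotomy_right hc₀ hpos hcc with h | h
    · exact hR fun x hx =>
        hs'.trans (gapSlope_le_of_nonneg hx.1 fun y hy => h y ⟨hy.1, hy.2.trans hx.2⟩)
    · rcases le_total (gapSlope M c) 0 with hk | hk
      · have hlim : Tendsto (fun x : ℝ => -Real.exp (-(M * x))) atTop (𝓝 0) := by
          have h1 : Tendsto (fun x : ℝ => -(M * x)) atTop atBot :=
            tendsto_neg_atTop_atBot.comp (tendsto_id.const_mul_atTop hM)
          simpa using (Real.tendsto_exp_atBot.comp h1).neg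
        refine le_of_tendsto hlim ?_
        filter_upwards [eventually_ge_atTop c] with x hx
        refine (neg_exp_le_liftGap x).trans (liftGap_le_of_nonpos hx fun y hy => ?_)
        exact (gapSlope_le_of_nonpos hy.1 fun z hz => h z hz.1).trans hk
      · refine hR fun x hx => ?_
        rcases gapCurv_dichotomy_right hc₀ hpos hx.1 with h' | h'
        · exact hs'.trans (gapSlope_le_of_nonneg hx.1 h')
        · exact (neg_nonpos.2 hε).trans (hk.trans
            (gapSlope_le_of_nonpos hx.2 fun y hy => h' y hy.1))

end gap

/-! ### Numerical verification at `c = 3.617`. -/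

section numerics

/-- The point `3.617` approximates the maximizer of `liftFun 1`. Even and odd numbers of Taylor
terms bound from below and above. -/
theorem gaussInt_bounds :
    1.2529406029 ≤ gaussInt 3.617 ∧ gaussInt 3.617 ≤ 1.252940603 := by
  constructor
  · refine le_trans ?_ (gaussTaylor_le (N := 32) (by decide) (by norm_num))
    norm_num [gaussTaylor, Finset.sum_range_succ, Nat.factorial]
  · refine le_trans (le_gaussTaylor (N := 33) (by decide) (by norm_num)) ?_
    norm_num [gaussTaylor, Finset.sum_range_succ, Nat.factorial]

/-- The exponent is `-(M * c + c ^ 2 / 2)` at `c = 3.617` with `M = 0.244395`, the upper end of the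
tolerance interval; `exp_neg_lower` uses the lower end. -/
theorem exp_neg_upper : Real.exp (-7.425321215) ≤ 0.00059597 := by
  refine le_trans (le_expTaylor (N := 39) (by decide) (by norm_num)) ?_
  norm_num [expTaylor, Finset.sum_range_succ, Nat.factorial]

theorem exp_neg_lower : 0.00059599 ≤ Real.exp (-7.425285045) := by
  refine le_trans ?_ (expTaylor_le (N := 38) (by decide) (by norm_num))
  norm_num [expTaylor, Finset.sum_range_succ, Nat.factorial]

theorem exp_neg_bounds :
    0.4131367 ≤ Real.exp (-0.883976715) ∧ Real.exp (-0.883976715) ≤ 0.4131368 := by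
  constructor
  · refine le_trans ?_ (expTaylor_le (N := 14) (by decide) (by norm_num))
    norm_num [expTaylor, Finset.sum_range_succ, Nat.factorial]
  · refine le_trans (le_expTaylor (N := 13) (by decide) (by norm_num)) ?_
    norm_num [expTaylor, Finset.sum_range_succ, Nat.factorial]

theorem gaussInt_sq_bounds :
    0.99940401 < 2 / Real.pi * gaussInt 3.617 ^ 2 ∧
      2 / Real.pi * gaussInt 3.617 ^ 2 ≤ 1 - 0.00059597 - 0.000000015 := by
  obtain ⟨h1, h2⟩ := gaussInt_bounds
  have p1 := Real.pi_gt_d20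
  have p2 := Real.pi_lt_d20
  have s1 : (1.2529406029 : ℝ) ^ 2 ≤ gaussInt 3.617 ^ 2 := by gcongr
  have s2 : gaussInt 3.617 ^ 2 ≤ (1.252940603 : ℝ) ^ 2 := by gcongr
  constructor
  · rw [div_mul_eq_mul_div, lt_div_iff₀ Real.pi_pos]
    linarith
  · rw [div_mul_eq_mul_div, div_le_iff₀ Real.pi_pos]
    linarith

theorem gapSlope_bounds : -0.00002 ≤ gapSlope 0.244395 3.617 ∧ gapSlope 0.244395 3.617 ≤ 0 := by
  obtain ⟨h1, h2⟩ := gaussInt_bounds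
  obtain ⟨e1, e2⟩ := exp_neg_bounds
  have p1 := Real.pi_gt_d20
  have p2 := Real.pi_lt_d20
  have e : (0.244395 : ℝ) * 3.617 = 0.883976715 := by norm_num
  have q1 : 1.59529 ≤ 4 / Real.pi * gaussInt 3.617 := by
    rw [div_mul_eq_mul_div, le_div_iff₀ Real.pi_pos]
    linarith
  have q2 : 4 / Real.pi * gaussInt 3.617 ≤ 1.5953 := by
    rw [div_mul_eq_mul_div, div_le_iff₀ Real.pi_pos]
    linarith
  rw [gapSlope, e]
  constructor <;> linarith

theorem gapCurv_nonpos {c : ℝ} (hc : c ∈ Icc (0 : ℝ) (1 + 0.244395)) :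
    gapCurv 0.244395 c ≤ 0 := by
  have h1 := Real.add_one_le_exp (0.244395 * c - c ^ 2 / 2)
  have h2 : 1.27 ≤ 4 / Real.pi := by
    rw [le_div_iff₀ Real.pi_pos]; linarith [Real.pi_lt_d4]
  have h3 := mul_le_mul_of_nonneg_right h2 (Real.exp_pos (0.244395 * c - c ^ 2 / 2)).le
  have h4 := mul_nonneg hc.1 (sub_nonneg.2 hc.2)
  unfold gapCurv
  linarith [hc.1, hc.2]

theorem gapCurv_pos : 0 < gapCurv 0.244395 3.617 := by
  have h1 : Real.exp (0.244395 * 3.617 - 3.617 ^ 2 / 2) ≤ Real.exp (-5) :=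
    Real.exp_le_exp.2 (by norm_num)
  have h2 : Real.exp (-5) ≤ 0.01 := by
    refine le_trans (le_expTaylor (N := 21) (by decide) (by norm_num)) ?_
    norm_num [expTaylor, Finset.sum_range_succ, Nat.factorial]
  have h3 : 4 / Real.pi ≤ 2 := by
    rw [div_le_iff₀ Real.pi_pos]; linarith [Real.pi_gt_d2]
  have h4 := mul_le_mul h3 (h1.trans h2) (Real.exp_pos _).le (by norm_num)
  unfold gapCurv
  linarith

theorem liftFun_one_le {c : ℝ} (hc : 0 < c) : liftFun 1 c ≤ 0.244395 := by
  rw [liftFun_one_le_iff hc]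
  refine liftGap_nonneg (fun c hc => gapCurv_nonpos hc) (c₀ := 3.617) (by norm_num) gapCurv_pos
    (by norm_num) (ε := 0.00002) (by norm_num) gapSlope_bounds.2 gapSlope_bounds.1 ?_ hc.le
  -- The possible loss to the right of `c₀` is below `10⁻⁸`, within the slack `1.5 * 10⁻⁸` built
  -- into `gaussInt_sq_bounds`.
  have h1 : √(Real.pi / 2) ≤ 1.2534 := by
    rw [Real.sqrt_le_left (by norm_num)]
    linarith [Real.pi_lt_d6]
  have h2 := gaussInt_bounds.1
  have h3 := gaussInt_sq_bounds.2
  have h4 := exp_neg_upper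
  rw [liftGap, show (0.244395 * 3.617 + 3.617 ^ 2 / 2 : ℝ) = 7.425321215 by norm_num]
  linarith

theorem le_liftFun_one : 0.244385 ≤ liftFun 1 3.617 := by
  by_contra! h
  have h1 := (liftFun_one_le_iff (by norm_num)).1 h.le
  rw [show (0.244385 * 3.617 + 3.617 ^ 2 / 2 : ℝ) = 7.425285045 by norm_num] at h1
  linarith [gaussInt_sq_bounds.1, exp_neg_lower]

theorem abs_liftedBound_one_sub_le : |liftedBound 1 - 0.24439| ≤ 0.000005 := by
  have h := isGreatest_liftedBound one_pos
  have h1 : liftedBound 1 ≤ 0.244395 := by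
    obtain ⟨c, hc, e⟩ := h.1
    rw [← e]
    exact liftFun_one_le hc
  have h2 : 0.244385 ≤ liftedBound 1 :=
    le_liftFun_one.trans (h.2 (mem_image_of_mem _ (by norm_num : (3.617 : ℝ) ∈ Ioi 0)))
  rw [abs_le]
  constructor <;> linarith

end numerics

/-! ### Bounds on the mean and the lower tail in fixed dimensions. -/

section consequences

variable {m n : ℕ} {Ω : Type*} [MeasurableSpace Ω] {P : Measure Ω} [IsProbabilityMeasure P]
  {H : Ω → Matrix (Fin m) (Fin n) ℝ}

/-- Jensen's inequality for `exp` applied to the exponential moment bound. -/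
theorem IsStdGaussianMatrix.liftFun_le_integral_div (hH : IsStdGaussianMatrix H P)
    (hm : 0 < m) (hn : 0 < n) {c : ℝ} (hc : 0 < c) :
    liftFun (m / n) c ≤ (∫ ω, minmaxForm (H ω) ∂P) / √(n : ℝ) := by
  have hn' : (0 : ℝ) < n := by exact_mod_cast hn
  have hsn : 0 < √(n : ℝ) := Real.sqrt_pos.2 hn'
  have hsq : √(n : ℝ) * √(n : ℝ) = n := Real.mul_self_sqrt hn'.le
  have key := hH.lintegral_exp_le hm hn hc
  have hmeas : AEStronglyMeasurable (fun ω => Real.exp (-(c * √(n : ℝ)) * minmaxForm (H ω))) P :=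
    (Real.continuous_exp.measurable.comp_aemeasurable
      (hH.aemeasurable_minmaxForm.const_mul _)).aestronglyMeasurable
  have hint : Integrable (fun ω => Real.exp (-(c * √(n : ℝ)) * minmaxForm (H ω))) P := by
    refine ⟨hmeas, ?_⟩
    rw [hasFiniteIntegral_iff_ofReal (ae_of_all _ fun ω => (Real.exp_pos _).le)]
    exact key.trans_lt ENNReal.ofReal_lt_top
  rw [← ofReal_integral_eq_lintegral_ofReal hint (ae_of_all _ fun ω => (Real.exp_pos _).le),
    ENNReal.ofReal_le_ofReal_iff (Real.exp_pos _).le] at key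
  have hJ := convexOn_exp.map_integral_le (μ := P)
    (f := fun ω => -(c * √(n : ℝ)) * minmaxForm (H ω)) Real.continuous_exp.continuousOn isClosed_univ
    (ae_of_all _ fun ω => mem_univ _) (hH.integrable_minmaxForm.const_mul _) hint
  have h := Real.exp_le_exp.1 (hJ.trans key)
  rw [integral_const_mul, neg_mul, neg_le_neg_iff] at h
  rw [le_div_iff₀ hsn]
  refine le_of_mul_le_mul_left (a := c * √(n : ℝ)) ?_ (mul_pos hc hsn)
  calc c * √(n : ℝ) * (liftFun (m / n) c * √(n : ℝ))
      = (√(n : ℝ) * √(n : ℝ)) * c * liftFun (m / n) c := by ring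
    _ = n * c * liftFun (m / n) c := by rw [hsq]
    _ ≤ _ := h

/-- Chernoff bound: Markov's inequality for the same exponential moment. -/
theorem IsStdGaussianMatrix.measure_lt_le (hH : IsStdGaussianMatrix H P)
    (hm : 0 < m) (hn : 0 < n) {c : ℝ} (hc : 0 < c) (s : ℝ) :
    P {ω | s * √(n : ℝ) ≤ minmaxForm (H ω)}ᶜ ≤
      ENNReal.ofReal (Real.exp (n * (c * (s - liftFun (m / n) c)))) := by
  have hn' : (0 : ℝ) < n := by exact_mod_cast hn
  have hsn : 0 < √(n : ℝ) := Real.sqrt_pos.2 hn'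
  have hsq : √(n : ℝ) * √(n : ℝ) = n := Real.mul_self_sqrt hn'.le
  have key := hH.lintegral_exp_le hm hn hc
  set d := c * √(n : ℝ)
  have hd : 0 < d := mul_pos hc hsn
  have hmeas : AEMeasurable (fun ω => ENNReal.ofReal (Real.exp (-d * minmaxForm (H ω)))) P :=
    (Real.continuous_exp.measurable.comp_aemeasurable
      (hH.aemeasurable_minmaxForm.const_mul _)).ennreal_ofReal
  have hsub : {ω | s * √(n : ℝ) ≤ minmaxForm (H ω)}ᶜ ⊆ {ω | ENNReal.ofReal (Real.exp (-(n * c * s))) ≤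
      ENNReal.ofReal (Real.exp (-d * minmaxForm (H ω)))} := by
    intro ω hω
    have hω' : minmaxForm (H ω) < s * √(n : ℝ) := not_le.1 hω
    refine ENNReal.ofReal_le_ofReal (Real.exp_le_exp.2 ?_)
    have h1 := mul_le_mul_of_nonneg_left hω'.le hd.le
    have h2 : d * (s * √(n : ℝ)) = n * c * s := by
      simp only [d]; linear_combination c * s * hsq
    linarith
  have h := (mul_meas_ge_le_lintegral₀ hmeas (ENNReal.ofReal (Real.exp (-(n * c * s))))).trans key
  have hpos : 0 < Real.exp (-(n * c * s)) := Real.exp_pos _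
  refine (measure_mono hsub).trans ?_
  rw [mul_comm, ← ENNReal.le_div_iff_mul_le (Or.inl (ENNReal.ofReal_pos.2 hpos).ne')
    (Or.inl ENNReal.ofReal_ne_top), ← ENNReal.ofReal_div_of_pos hpos, ← Real.exp_sub] at h
  refine h.trans (le_of_eq ?_)
  congr 2
  ring

theorem IsStdGaussianMatrix.liftedBound_le {α : ℝ} (hα : 0 < α) (hH : IsStdGaussianMatrix H P)
    (hn : 0 < n) (hmn : (m : ℝ) = α * n) :
    liftedBound α ≤ (∫ ω, minmaxForm (H ω) ∂P) / √(n : ℝ) := by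
  have hn' : (0 : ℝ) < n := by exact_mod_cast hn
  have hm : 0 < m := by
    have : (0 : ℝ) < m := by rw [hmn]; positivity
    exact_mod_cast this
  have hα' : (m : ℝ) / n = α := by rw [hmn]; field_simp
  obtain ⟨c, hc, e⟩ := (isGreatest_liftedBound hα).1
  have := hH.liftFun_le_integral_div hm hn hc
  rwa [hα', e] at this

end consequences

/-! ### Limits along growing dimensions. -/

section asymptotics

theorem continuousAt_liftFun_left {α : ℝ} (hα : 0 < α) (c : ℝ) :
    ContinuousAt (fun β => liftFun β c) α := by
  have h1 : ContinuousAt (fun β : ℝ => c / √(2 * β)) α :=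
    continuousAt_const.div (by fun_prop) (by positivity)
  have h2 : ContinuousAt (fun β : ℝ => Real.log (erfc (c / √(2 * β)))) α :=
    (continuous_erfc.continuousAt.comp h1).log (erfc_pos _).ne'
  unfold liftFun
  exact continuousAt_const.sub ((continuousAt_id.div_const c).mul h2)

theorem tendsto_measure_one_of_subset {Ω : ℕ → Type*} [∀ k, MeasurableSpace (Ω k)]
    {P : ∀ k, Measure (Ω k)} [∀ k, IsProbabilityMeasure (P k)] {A B : ∀ k, Set (Ω k)}
    (hA : Tendsto (fun k => P k (A k)) atTop (𝓝 1)) (hAB : ∀ᶠ k in atTop, A k ⊆ B k) :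
    Tendsto (fun k => P k (B k)) atTop (𝓝 1) :=
  tendsto_of_tendsto_of_tendsto_of_le_of_le' hA tendsto_const_nhds
    (hAB.mono fun _ h => measure_mono h) (Eventually.of_forall fun _ => prob_le_one)

/-- Subadditivity suffices, so the events need not be measurable. -/
theorem tendsto_measure_one_of_compl {Ω : ℕ → Type*} [∀ k, MeasurableSpace (Ω k)]
    {P : ∀ k, Measure (Ω k)} [∀ k, IsProbabilityMeasure (P k)] {A : ∀ k, Set (Ω k)}
    (hA : Tendsto (fun k => P k (A k)ᶜ) atTop (𝓝 0)) :
    Tendsto (fun k => P k (A k)) atTop (𝓝 1) := by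
  have h1 : Tendsto (fun k => 1 - P k (A k)ᶜ) atTop (𝓝 1) := by
    simpa using ENNReal.Tendsto.sub tendsto_const_nhds hA (Or.inl ENNReal.one_ne_top)
  refine tendsto_of_tendsto_of_tendsto_of_le_of_le h1 tendsto_const_nhds (fun k => ?_)
    fun _ => prob_le_one
  rw [tsub_le_iff_right, ← measure_univ (μ := P k), ← union_compl_self (A k)]
  exact measure_union_le _ _

variable {α : ℝ} {m n : ℕ → ℕ} {Ω : ℕ → Type*} [∀ k, MeasurableSpace (Ω k)]
  {P : ∀ k, Measure (Ω k)} [∀ k, IsProbabilityMeasure (P k)]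
  {H : ∀ k, Ω k → Matrix (Fin (m k)) (Fin (n k)) ℝ}

/-- Fix `c` as a maximizer for the limit `α`; continuity of `liftFun` in its first argument at this
one `c` is enough. The intermediate `s'` leaves a fixed gap for exponential decay. -/
theorem exists_eventually_lt_liftFun (hα : 0 < α) (hn : Tendsto n atTop atTop)
    (hmn : Tendsto (fun k => (m k : ℝ) / n k) atTop (𝓝 α)) {s : ℝ} (hs : s < liftedBound α) :
    ∃ c > 0, ∃ s' > s, ∀ᶠ k in atTop, 0 < m k ∧ 0 < n k ∧ s' < liftFun (m k / n k) c := by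
  obtain ⟨c, hc, e⟩ := (isGreatest_liftedBound hα).1
  obtain ⟨s', hs1, hs2⟩ := exists_between hs
  refine ⟨c, hc, s', hs1, ?_⟩
  rw [← e] at hs2
  filter_upwards [((continuousAt_liftFun_left hα c).tendsto.comp hmn).eventually (lt_mem_nhds hs2),
    hmn.eventually (lt_mem_nhds hα), hn.eventually_gt_atTop 0] with k h1 h2 h3
  refine ⟨Nat.pos_of_ne_zero fun h0 => ?_, h3, h1⟩
  simp [h0] at h2

theorem eventually_le_integral_div (hα : 0 < α) (hn : Tendsto n atTop atTop)
    (hmn : Tendsto (fun k => (m k : ℝ) / n k) atTop (𝓝 α))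
    (hH : ∀ k, IsStdGaussianMatrix (H k) (P k)) {s : ℝ} (hs : s < liftedBound α) :
    ∀ᶠ k in atTop, s ≤ (∫ ω, minmaxForm (H k ω) ∂(P k)) / √(n k : ℝ) := by
  obtain ⟨c, hc, s', hs', h⟩ := exists_eventually_lt_liftFun hα hn hmn hs
  filter_upwards [h] with k ⟨hmk, hnk, hk⟩
  exact (hs'.lt.trans hk).le.trans ((hH k).liftFun_le_integral_div hmk hnk hc)

theorem tendsto_measure_le_minmaxForm (hα : 0 < α) (hn : Tendsto n atTop atTop)
    (hmn : Tendsto (fun k => (m k : ℝ) / n k) atTop (𝓝 α))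
    (hH : ∀ k, IsStdGaussianMatrix (H k) (P k)) {s : ℝ} (hs : s < liftedBound α) :
    Tendsto (fun k => P k {ω | s * √(n k : ℝ) ≤ minmaxForm (H k ω)}) atTop (𝓝 1) := by
  obtain ⟨c, hc, s', hs', h⟩ := exists_eventually_lt_liftFun hα hn hmn hs
  refine tendsto_measure_one_of_compl ?_
  have hneg : c * (s - s') < 0 := mul_neg_of_pos_of_neg hc (sub_neg.2 hs')
  have hlim : Tendsto (fun k => ENNReal.ofReal (Real.exp ((n k : ℝ) * (c * (s - s')))))
      atTop (𝓝 0) := by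
    rw [← ENNReal.ofReal_zero]
    exact ENNReal.tendsto_ofReal (Real.tendsto_exp_atBot.comp
      ((tendsto_natCast_atTop_atTop.comp hn).atTop_mul_const_of_neg hneg))
  refine tendsto_of_tendsto_of_tendsto_of_le_of_le' tendsto_const_nhds hlim
    (Eventually.of_forall fun _ => zero_le) ?_
  filter_upwards [h] with k ⟨hmk, hnk, hk⟩
  refine ((hH k).measure_lt_le hmk hnk hc s).trans (ENNReal.ofReal_le_ofReal ?_)
  gcongr

/-- Positivity of the bound lets the unscaled events follow from the scaled ones at level
`liftedBound α / 2`, as soon as `√n ≥ 2`. -/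
theorem eventually_liftedBound_le_half_mul_sqrt (hα : 0 < α) (hn : Tendsto n atTop atTop) :
    ∀ᶠ k in atTop, liftedBound α ≤ liftedBound α / 2 * √(n k : ℝ) := by
  filter_upwards [hn.eventually_ge_atTop 4] with k hk
  have h1 : (2 : ℝ) ≤ √(n k : ℝ) := by
    refine Real.le_sqrt_of_sq_le ?_
    have : (4 : ℝ) ≤ n k := by exact_mod_cast hk
    linarith
  nlinarith [liftedBound_pos hα]

end asymptotics

end LittleModel

theorem mainTheorem5 (α : ℝ) (hα : 0 < α) :
    -- the maximum that defines the bound is attained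
    IsGreatest (LittleModel.liftFun α '' Ioi 0) (LittleModel.liftedBound α) ∧
    -- bound on the expectation, for all dimensions with `m = α n`
    (∀ (m n : ℕ) (Ω : Type u) [MeasurableSpace Ω] (P : Measure Ω) [IsProbabilityMeasure P]
        (H : Ω → Matrix (Fin m) (Fin n) ℝ),
      0 < n → (m : ℝ) = α * n → LittleModel.IsStdGaussianMatrix H P →
      Integrable (fun ω => LittleModel.minmaxForm (H ω)) P ∧
      LittleModel.liftedBound α ≤ (∫ ω, LittleModel.minmaxForm (H ω) ∂P) / √(n : ℝ)) ∧
    -- asymptotic statements, for dimensions tending to infinity with `m / n → α`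
    (∀ (m n : ℕ → ℕ) (Ω : ℕ → Type u) [∀ k, MeasurableSpace (Ω k)] (P : ∀ k, Measure (Ω k))
        [∀ k, IsProbabilityMeasure (P k)] (H : ∀ k, Ω k → Matrix (Fin (m k)) (Fin (n k)) ℝ),
      Tendsto n atTop atTop → Tendsto (fun k => (m k : ℝ) / n k) atTop (𝓝 α) →
      (∀ k, LittleModel.IsStdGaussianMatrix (H k) (P k)) →
      (∀ s < LittleModel.liftedBound α, ∀ᶠ k in atTop,
        s ≤ (∫ ω, LittleModel.minmaxForm (H k ω) ∂(P k)) / √(n k : ℝ)) ∧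
      (∀ s < LittleModel.liftedBound α,
        Tendsto (fun k => P k {ω | s * √(n k : ℝ) ≤ LittleModel.minmaxForm (H k ω)})
          atTop (𝓝 1)) ∧
      (∀ s, 0 ≤ s → s < LittleModel.liftedBound α →
        Tendsto (fun k => P k {ω | (s * √(n k : ℝ)) ^ 2 ≤ LittleModel.minmaxForm (H k ω) ^ 2})
          atTop (𝓝 1)) ∧
      Tendsto (fun k => P k {ω | LittleModel.liftedBound α ≤ LittleModel.minmaxForm (H k ω)})
        atTop (𝓝 1) ∧
      Tendsto
        (fun k => P k {ω | LittleModel.liftedBound α ^ 2 ≤ LittleModel.minmaxForm (H k ω) ^ 2})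
        atTop (𝓝 1)) ∧
    -- numerical value for `α = 1`, to five decimals
    |LittleModel.liftedBound 1 - 0.24439| ≤ 0.000005 := by
  refine ⟨LittleModel.isGreatest_liftedBound hα, ?_, ?_, LittleModel.abs_liftedBound_one_sub_le⟩
  · intro m n Ω _ P _ H hn hmn hH
    exact ⟨hH.integrable_minmaxForm, hH.liftedBound_le hα hn hmn⟩
  · intro m n Ω _ P _ H hn hmn hH
    have hL := LittleModel.liftedBound_pos hα
    have hmain : ∀ s < LittleModel.liftedBound α,
        Tendsto (fun k => P k {ω | s * √(n k : ℝ) ≤ LittleModel.minmaxForm (H k ω)})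
          atTop (𝓝 1) := fun s hs => LittleModel.tendsto_measure_le_minmaxForm hα hn hmn hH hs
    have hhalf := hmain _ (half_lt_self hL)
    have hlarge := LittleModel.eventually_liftedBound_le_half_mul_sqrt hα hn
    refine ⟨fun s hs => LittleModel.eventually_le_integral_div hα hn hmn hH hs, hmain,
      fun s hs0 hs => ?_, ?_, ?_⟩
    · exact LittleModel.tendsto_measure_one_of_subset (hmain s hs) (Eventually.of_forall
        fun k ω hω => pow_le_pow_left₀ (mul_nonneg hs0 (Real.sqrt_nonneg _)) hω 2)
    · exact LittleModel.tendsto_measure_one_of_subset hhalf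
        (hlarge.mono fun k hk ω hω => hk.trans hω)
    · exact LittleModel.tendsto_measure_one_of_subset hhalf
        (hlarge.mono fun k hk ω hω => pow_le_pow_left₀ hL.le (hk.trans hω) 2)
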